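/- All spaces are over $\mathbb{R}$. Let $(\Gamma,\Sigma,\sigma)$ be a finite measure space and let $S=(S_t)_{t\ge 0}$ be a $C_0$-semigroup on $L_2(\Gamma)$ with generator $-A$. Suppose that - $S$ is self-adjoint: every $S_t$ ($t>0$) is a self-adjoint operator; - $S$ is a Markov semigroup: for all $t>0$ one has $S_t\mathbb{1}_\Gamma=\mathbb{1}_\Gamma$, and $S_tf\ge 0$ for all $f\in L_2(\Gamma)$ with $f\ge 0$; - $S$ is irreducible: if $\Gamma_1\in\Sigma$ and $S_tL_2(\Gamma_1)\subset L_2(\Gamma_1)$ for all $t>0$, where $L_2(\Gamma_1)=\{f\in L_2(\Gamma): f=0\text{ a.e. on }\Gamma\setminus\Gamma_1\}$, then $\sigma(\Gamma_1)=0$ or $\sigma(\Gamma\setminus\Gamma_1)=0$. For $p\in[1,\infty)$ and $f\in L_p(\Gamma)$ put $Pf=\frac{1}{\sigma(\Gamma)}\Big(\int_\Gamma f\,d\sigma\Big)\mathbb{1}_\Gamma$ (with $P=0$ in the trivial case $\sigma(\Gamma)=0$). Here $0\notin\sigma_{\rm ess}(A)$ means that $0$ is not an accumulation point of the spectrum $\sigma(A)$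 and that $\ker A$ is finite dimensional. Then the following are equivalent. 1. $0\notin\sigma_{\rm ess}(A)$. 2. $\lim_{t\to\infty}S_t=P$ in $\mathcal{L}(L_2(\Gamma))$, i.e. in operator norm. 3. There exists an $\varepsilon>0$ such that $\|S_t-P\|_{\mathcal{L}(L_2(\Gamma))}\le e^{-\varepsilon t}$ for all $t>0$. Moreover, for all $p\in(1,\infty)$ and $t\ge 0$ there is a unique $S^{(p)}_t\in\mathcal{L}(L_p(\Gamma))$ with $S^{(p)}_tf=S_tf$ for all $f\in L_2(\Gamma)\cap L_p(\Gamma)$, and if the equivalent conditions 1–3 hold, then $\lim_{t\to\infty}S^{(p)}_t=P$ in $\mathcal{L}(L_p(\Gamma))$ for all $p\in(1,\infty)$. -/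

import Mathlib

open MeasureTheory Filter Topology
open scoped ENNReal NNReal

noncomputable section

section Semigroup

/-- A `C₀`-semigroup (strongly continuous one-parameter semigroup of bounded operators)
on a real Banach space, with `S 0 = I`. -/
structure C0Semigroup (X : Type*) [NormedAddCommGroup X] [NormedSpace ℝ X] where
  /-- The operator at time `t`. -/
  op : ℝ≥0 → (X →L[ℝ] X)
  op_zero : op 0 = ContinuousLinearMap.id ℝ X
  op_add : ∀ s t : ℝ≥0, op (s + t) = (op s).comp (op t)
  tendsto_op : ∀ x : X, Tendsto (fun t : ℝ≥0 => op t x) (𝓝[>] 0) (𝓝 x)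

namespace C0Semigroup

variable {X : Type*} [NormedAddCommGroup X] [NormedSpace ℝ X]

/-- The difference quotient `(S_t x - x) / t`, as a linear map in `x`. -/
def diffQuot (S : C0Semigroup X) (t : ℝ≥0) : X →ₗ[ℝ] X :=
  (t : ℝ)⁻¹ • ((S.op t : X →ₗ[ℝ] X) - LinearMap.id)

theorem diffQuot_apply (S : C0Semigroup X) (t : ℝ≥0) (x : X) :
    S.diffQuot t x = (t : ℝ)⁻¹ • (S.op t x - x) := rfl

/-- The domain of the generator: all `x` for which `(S_t x - x) / t` converges in norm
as `t ↓ 0`. -/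
def generatorDomain (S : C0Semigroup X) : Submodule ℝ X where
  carrier := {x | ∃ y, Tendsto (fun t : ℝ≥0 => S.diffQuot t x) (𝓝[>] 0) (𝓝 y)}
  add_mem' := by
    rintro a b ⟨y, hy⟩ ⟨z, hz⟩
    refine ⟨y + z, ?_⟩
    simpa only [map_add] using hy.add hz
  zero_mem' := ⟨0, by simpa only [map_zero] using tendsto_const_nhds⟩
  smul_mem' := by
    rintro c a ⟨y, hy⟩
    refine ⟨c • y, ?_⟩
    simpa only [map_smul] using hy.const_smul c

/-- The generator `G` of `S`, an unbounded operator: `G x = lim_{t ↓ 0} (S_t x - x) / t`. -/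
def generator (S : C0Semigroup X) : X →ₗ.[ℝ] X where
  domain := S.generatorDomain
  toFun :=
    { toFun := fun x => x.2.choose
      map_add' := fun a b => by
        refine tendsto_nhds_unique (a + b).2.choose_spec ?_
        have h := a.2.choose_spec.add b.2.choose_spec
        simpa only [Submodule.coe_add, map_add] using h
      map_smul' := fun c a => by
        refine tendsto_nhds_unique (c • a).2.choose_spec ?_
        have h := a.2.choose_spec.const_smul c
        simpa only [Submodule.coe_smul, map_smul, RingHom.id_apply] using h }

theorem tendsto_generator (S : C0Semigroup X) (x : S.generator.domain) :
    Tendsto (fun t : ℝ≥0 => (t : ℝ)⁻¹ • (S.op t (x : X) - (x : X))) (𝓝[>] 0)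
      (𝓝 (S.generator x)) :=
  x.2.choose_spec

end C0Semigroup

end Semigroup

section Spectrum

variable {X : Type*} [NormedAddCommGroup X] [NormedSpace ℝ X]

/-- The operator `l - A`, with domain `D(A)`. -/
def LinearPMap.smulIdSub (A : X →ₗ.[ℝ] X) (l : ℝ) : A.domain →ₗ[ℝ] X :=
  l • A.domain.subtype - A.toFun

/-- The spectrum of an unbounded operator `A`: all real `l` for which `l - A : D(A) → X`
has no bounded two-sided inverse `R : X → D(A)`. (The spectrum of a self-adjoint operator
is real, so real `l` suffice for these.) -/
def LinearPMap.realSpectrum (A : X →ₗ.[ℝ] X) : Set ℝ :=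
  {l | ¬ ∃ R : X →L[ℝ] X,
    (∀ x : X, ∃ h : R x ∈ A.domain, A.smulIdSub l ⟨R x, h⟩ = x) ∧
    (∀ x : A.domain, R (A.smulIdSub l x) = x)}

/-- The essential spectrum of a self-adjoint operator `A`: all `l` which are accumulation
points of the spectrum of `A` or for which `ker (l - A)` is infinite dimensional. -/
def LinearPMap.essSpectrum (A : X →ₗ.[ℝ] X) : Set ℝ :=
  {l | AccPt l (𝓟 A.realSpectrum) ∨
    ¬ FiniteDimensional ℝ (LinearMap.ker (A.smulIdSub l))}

end Spectrum

section Markov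

variable {Γ : Type*} [MeasurableSpace Γ] {μ : Measure Γ} [IsFiniteMeasure μ]

/-- A Markov operator on `L₂`: it maps the constant function `1` to itself and
nonnegative functions to nonnegative functions. -/
def IsMarkovOperator (T : Lp ℝ 2 μ →L[ℝ] Lp ℝ 2 μ) : Prop :=
  T (Lp.const 2 μ (1 : ℝ)) = Lp.const 2 μ (1 : ℝ) ∧ ∀ f : Lp ℝ 2 μ, 0 ≤ f → 0 ≤ T f

/-- A Markov semigroup on `L₂`. -/
def IsMarkovSemigroup (S : C0Semigroup (Lp ℝ 2 μ)) : Prop :=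
  ∀ t : ℝ≥0, 0 < t → IsMarkovOperator (S.op t)

/-- A semigroup consisting of self-adjoint operators. -/
def IsSelfAdjointSemigroup (S : C0Semigroup (Lp ℝ 2 μ)) : Prop :=
  ∀ t : ℝ≥0, 0 < t → IsSelfAdjoint (S.op t)

variable (μ) in
/-- `L₂(Γ₁)` inside `L₂(Γ)`: the functions vanishing a.e. outside `Γ₁`. -/
def L2On (Γ₁ : Set Γ) : Set (Lp ℝ 2 μ) :=
  {f | ∀ᵐ x ∂μ, x ∉ Γ₁ → f x = 0}

/-- Irreducibility: only trivial measurable sets `Γ₁` have an invariant `L₂(Γ₁)`. -/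
def IsIrreducibleSemigroup (S : C0Semigroup (Lp ℝ 2 μ)) : Prop :=
  ∀ Γ₁ : Set Γ, MeasurableSet Γ₁ →
    (∀ t : ℝ≥0, 0 < t → ∀ f ∈ L2On μ Γ₁, S.op t f ∈ L2On μ Γ₁) →
    μ Γ₁ = 0 ∨ μ Γ₁ᶜ = 0

/-- `U` is the operator `T^(p)` on `L_p` belonging to an operator `T` on `L₂`, i.e.
`U f = T f` for all `f ∈ L₂ ∩ L_p`. -/
def IsLpVersion {p : ℝ≥0∞} [Fact (1 ≤ p)] (T : Lp ℝ 2 μ →L[ℝ] Lp ℝ 2 μ)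
    (U : Lp ℝ p μ →L[ℝ] Lp ℝ p μ) : Prop :=
  ∀ (f : Lp ℝ 2 μ) (g : Lp ℝ p μ), f =ᵐ[μ] g → T f =ᵐ[μ] U g

theorem integrable_of_Lp {p : ℝ≥0∞} [hp : Fact (1 ≤ p)] (f : Lp ℝ p μ) : Integrable f μ :=
  (Lp.memLp f).integrable hp.out

variable (μ) in
/-- The integral `f ↦ ∫ f dμ` as a bounded linear functional on `L_p` of a finite measure. -/
def integralLp (p : ℝ≥0∞) [hp : Fact (1 ≤ p)] : Lp ℝ p μ →L[ℝ] ℝ :=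
  LinearMap.mkContinuous
    { toFun := fun f => ∫ x, f x ∂μ
      map_add' := fun f g => by
        rw [← integral_add (integrable_of_Lp f) (integrable_of_Lp g)]
        exact integral_congr_ae (Lp.coeFn_add f g)
      map_smul' := fun c f => by
        rw [RingHom.id_apply, smul_eq_mul, ← integral_const_mul]
        exact integral_congr_ae (Lp.coeFn_smul c f) }
    (μ Set.univ ^ (1 / (1 : ℝ≥0∞).toReal - 1 / p.toReal)).toReal
    (fun f => by
      have hne : μ Set.univ ^ (1 / (1 : ℝ≥0∞).toReal - 1 / p.toReal) ≠ ∞ := by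
        refine ENNReal.rpow_ne_top_of_nonneg ?_ (measure_ne_top μ _)
        rcases eq_or_ne p ∞ with h | h
        · simp [h]
        · have h1 : 1 ≤ p.toReal := by
            simpa using ENNReal.toReal_mono h hp.out
          simpa using inv_le_one_of_one_le₀ h1
      have h := eLpNorm_le_eLpNorm_mul_rpow_measure_univ (μ := μ) hp.out
        (Lp.aestronglyMeasurable f)
      have h2 := ENNReal.toReal_mono (ENNReal.mul_ne_top (Lp.eLpNorm_ne_top f) hne) h
      rw [ENNReal.toReal_mul, ← Lp.norm_def, mul_comm] at h2
      refine le_trans ?_ h2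
      have h3 := norm_integral_le_lintegral_norm (μ := μ) (f : Γ → ℝ)
      refine h3.trans (le_of_eq ?_)
      rw [eLpNorm_one_eq_lintegral_enorm]
      simp only [ofReal_norm])

theorem integralLp_apply {p : ℝ≥0∞} [Fact (1 ≤ p)] (f : Lp ℝ p μ) :
    integralLp μ p f = ∫ x, f x ∂μ := rfl

variable (μ) in
/-- The operator `P f = (μ(Γ)⁻¹ ∫ f dμ) 1` on `L_p`. -/
def meanProj (p : ℝ≥0∞) [Fact (1 ≤ p)] : Lp ℝ p μ →L[ℝ] Lp ℝ p μ :=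
  (Lp.constL p μ ℝ : ℝ →L[ℝ] Lp ℝ p μ).comp ((μ.real Set.univ)⁻¹ • integralLp μ p)

theorem meanProj_apply {p : ℝ≥0∞} [Fact (1 ≤ p)] (f : Lp ℝ p μ) :
    meanProj μ p f = Lp.const p μ ((μ.real Set.univ)⁻¹ * ∫ x, f x ∂μ) := rfl

end Markov

end

/-! Write G = -A for the generator. On a Hilbert space only a few facts about S and P matter: S
consists of symmetric contractions, and P is the symmetric projection onto the fixed vectors and
commutes with S (`IsErgodic`). For the mean value these come from the Markov property and
irreducibility. Jensen's inequality and invariance of the integral make S contractive. The positive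
part of a fixed function is again fixed, and its support is an invariant set; hence a fixed function
of mean zero has one sign and vanishes.

Norm convergence gives exponential decay because t ↦ ‖S_t - P‖ is submultiplicative. Symmetry gives
‖S_t - P‖² ≤ ‖S_{2t} - P‖, which removes the multiplicative constant. Decay at rate ε makes I - e^l
S_1 invertible for 0 ≠ l < ε, and with ∫₀¹ e^{ls} S_s ds this yields the resolvent
(`exists_isResolvent`). So 0 is at most an isolated point of the spectrum, and ker A lies in the
range of P, which is finite dimensional.

Conversely, suppose that (0, ε) contains no spectrum. No spectral theorem is used: the resolvent at
ε/2 has norm at most 2/ε (`norm_resolvent_le`), which is the inequality ε⟨Au, u⟩ ≤ ‖Au‖² (`gap`).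
Two differential inequalities along orbits turn it into decay at rate ε (`norm_op_sub_le_of_gap`),
and density of the domain finishes.

For L_p, put D = S_t - P. It has norm at most 2 on bounded functions and small norm on L₂.
Interpolation gives small norm on L_p for p > 2 (`exists_lintegral_rpow_map_le`), and symmetry of D
transfers this to p < 2 by duality (`LpBoundedBy.dual`). -/

noncomputable section

/-! ### Orbits and generators of C₀-semigroups -/

namespace C0Semigroup

variable {X : Type*} [NormedAddCommGroup X] [NormedSpace ℝ X]

/-- `y` is the value of the generator at `x`. -/
def HasGenerator (S : C0Semigroup X) (x y : X) : Prop :=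
  Tendsto (fun t : ℝ≥0 => (t : ℝ)⁻¹ • (S.op t x - x)) (𝓝[>] 0) (𝓝 y)

theorem HasGenerator.mem {S : C0Semigroup X} {x y : X} (h : S.HasGenerator x y) :
    x ∈ S.generator.domain := ⟨y, h⟩

theorem HasGenerator.generator_eq {S : C0Semigroup X} {x y : X} (h : S.HasGenerator x y)
    (hx : x ∈ S.generator.domain) : S.generator ⟨x, hx⟩ = y :=
  tendsto_nhds_unique (S.tendsto_generator ⟨x, hx⟩) h

theorem op_add_apply (S : C0Semigroup X) (s t : ℝ≥0) (x : X) :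
    S.op (s + t) x = S.op s (S.op t x) := by
  rw [S.op_add]; rfl

theorem op_zero_apply (S : C0Semigroup X) (x : X) : S.op 0 x = x := by
  rw [S.op_zero]; rfl

theorem op_comm_apply (S : C0Semigroup X) (s t : ℝ≥0) (x : X) :
    S.op s (S.op t x) = S.op t (S.op s x) := by
  rw [← op_add_apply, add_comm, op_add_apply]

theorem HasGenerator.op {S : C0Semigroup X} {x y : X} (h : S.HasGenerator x y) (t : ℝ≥0) :
    S.HasGenerator (S.op t x) (S.op t y) := by
  have := ((S.op t).continuous.tendsto y).comp h
  refine this.congr fun s => ?_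
  simp [S.op_comm_apply s t]

theorem tendsto_op_nhds (S : C0Semigroup X) (x : X) :
    Tendsto (fun t : ℝ≥0 => S.op t x) (𝓝 0) (𝓝 x) := by
  have h : insert (0 : ℝ≥0) (Set.Ioi 0) = Set.univ := by
    ext t; simp
  rw [← nhdsWithin_univ, ← h, nhdsWithin_insert, tendsto_sup]
  refine ⟨?_, S.tendsto_op x⟩
  rw [tendsto_pure_left]
  intro s hs
  rw [op_zero_apply]
  exact mem_of_mem_nhds hs

/-- For s ≤ t, contractivity of S_s bounds the distance of S_s x and S_t x by ‖S_{t-s} x - x‖, so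
continuity at 0 is enough. -/
theorem continuous_op_apply (S : C0Semigroup X) (hS : ∀ t x, ‖S.op t x‖ ≤ ‖x‖) (x : X) :
    Continuous fun t : ℝ≥0 => S.op t x := by
  have key : ∀ s t : ℝ≥0, dist (S.op s x) (S.op t x) ≤ ‖S.op (nndist s t) x - x‖ := by
    have aux : ∀ s t : ℝ≥0, s ≤ t → dist (S.op s x) (S.op t x) ≤ ‖S.op (nndist s t) x - x‖ := by
      intro s t hst
      have h1 : t = s + nndist s t := by
        apply NNReal.coe_injective
        have : (s : ℝ) ≤ t := hst
        simp [NNReal.dist_eq, abs_sub_comm (s : ℝ), abs_of_nonneg (sub_nonneg.2 this)]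
      conv_lhs => rw [h1]
      rw [op_add_apply, dist_comm, dist_eq_norm, ← map_sub]
      exact hS _ _
    intro s t
    rcases le_total s t with h | h
    · exact aux s t h
    · rw [dist_comm, nndist_comm]; exact aux t s h
  rw [continuous_iff_continuousAt]
  intro t
  rw [ContinuousAt, tendsto_iff_dist_tendsto_zero]
  refine squeeze_zero (fun _ => dist_nonneg) (fun s => key s t) ?_
  have h0 : Tendsto (fun s : ℝ≥0 => nndist s t) (𝓝 t) (𝓝 0) := by
    have : Continuous fun s : ℝ≥0 => nndist s t := by fun_prop
    simpa using this.tendsto t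
  have := (((S.tendsto_op_nhds x).comp h0).sub_const x).norm
  simpa using this

/-- The generator is a one-sided limit, so only right derivatives are available; together with
continuity they suffice for the mean value arguments below. -/
theorem hasDerivWithinAt_op (S : C0Semigroup X) {x y : X} (h : S.HasGenerator x y) {t : ℝ}
    (ht : 0 ≤ t) :
    HasDerivWithinAt (fun s : ℝ => S.op s.toNNReal x) (S.op t.toNNReal y) (Set.Ici t) t := by
  rw [← hasDerivWithinAt_Ioi_iff_Ici, hasDerivWithinAt_iff_tendsto_slope' (by simp)]
  have h1 : Tendsto (fun s : ℝ => (s - t).toNNReal) (𝓝[>] t) (𝓝[>] 0) := by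
    refine tendsto_nhdsWithin_iff.2 ⟨?_, ?_⟩
    · have : Continuous fun s : ℝ => (s - t).toNNReal := by fun_prop
      simpa using (this.tendsto t).mono_left nhdsWithin_le_nhds
    · filter_upwards [self_mem_nhdsWithin] with s hs
      simpa using hs
  have h2 := (h.op t.toNNReal).comp h1
  refine h2.congr' ?_
  filter_upwards [self_mem_nhdsWithin] with s hs
  have hs : t < s := hs
  have h3 : s.toNNReal = (s - t).toNNReal + t.toNNReal := by
    rw [← Real.toNNReal_add (by linarith) ht]; simp
  simp only [slope, Function.comp, vsub_eq_sub]
  rw [h3, op_add_apply, Real.coe_toNNReal _ (by linarith)]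

/-- The semigroup `e^{lt} S_t`. -/
def rescale (S : C0Semigroup X) (l : ℝ) : C0Semigroup X where
  op t := Real.exp (l * t) • S.op t
  op_zero := by simp [S.op_zero]
  op_add s t := by
    ext x
    simp [S.op_add, mul_add, Real.exp_add, smul_smul, mul_comm]
  tendsto_op x := by
    have h : Tendsto (fun t : ℝ≥0 => Real.exp (l * t)) (𝓝[>] 0) (𝓝 1) := by
      have : Continuous fun t : ℝ≥0 => Real.exp (l * t) := by fun_prop
      simpa using (this.tendsto 0).mono_left nhdsWithin_le_nhds
    simpa using h.smul (S.tendsto_op x)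

theorem rescale_op (S : C0Semigroup X) (l : ℝ) (t : ℝ≥0) (x : X) :
    (S.rescale l).op t x = Real.exp (l * t) • S.op t x := rfl

theorem HasGenerator.of_rescale {S : C0Semigroup X} {l : ℝ} {x y : X}
    (h : (S.rescale l).HasGenerator x y) : S.HasGenerator x (y - l • x) := by
  have h0 : Tendsto (fun t : ℝ≥0 => (t : ℝ)) (𝓝[>] 0) (𝓝[>] 0) := by
    refine tendsto_nhdsWithin_iff.2 ⟨?_, ?_⟩
    · have : Continuous fun t : ℝ≥0 => (t : ℝ) := by fun_prop
      simpa using (this.tendsto 0).mono_left nhdsWithin_le_nhds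
    · filter_upwards [self_mem_nhdsWithin] with s hs
      simpa using hs
  have h1 : Tendsto (fun t : ℝ≥0 => Real.exp (-(l * t))) (𝓝[>] 0) (𝓝 1) := by
    have : Continuous fun t : ℝ≥0 => Real.exp (-(l * t)) := by fun_prop
    simpa using (this.tendsto 0).mono_left nhdsWithin_le_nhds
  have h2 : Tendsto (fun t : ℝ≥0 => (t : ℝ)⁻¹ * (Real.exp (-(l * t)) - 1)) (𝓝[>] 0) (𝓝 (-l)) := by
    have hd : HasDerivAt (fun t : ℝ => Real.exp (-(l * t))) (-l) 0 := by
      have := ((hasDerivAt_id (0 : ℝ)).const_mul l).neg.exp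
      simpa using this
    have := (hd.tendsto_slope.mono_left (nhdsWithin_mono 0 (fun t (ht : 0 < t) => ht.ne'))).comp h0
    refine this.congr fun t => ?_
    simp [slope]
  -- Splits (S_t x - x)/t as e^{-lt} (e^{lt} S_t x - x)/t + ((e^{-lt} - 1)/t) x.
  have h3 := (h1.smul h).add (h2.smul_const x)
  rw [one_smul, neg_smul, ← sub_eq_add_neg] at h3
  refine h3.congr fun t => ?_
  rw [rescale_op, smul_comm _ (t : ℝ)⁻¹, mul_smul, ← smul_add]
  congr 1
  rw [smul_sub, smul_smul, ← Real.exp_add, sub_smul]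
  simp

/-- Shifting the integral by t leaves only its two ends: (S_t - I) ∫₀ᵀ = ∫_T^{T+t} - ∫₀ᵗ, and the
averages over these short intervals converge by continuity. -/
theorem hasGenerator_integral [CompleteSpace X] (S : C0Semigroup X)
    (hc : ∀ x, Continuous fun t : ℝ≥0 => S.op t x) (x : X) {T : ℝ} (hT : 0 ≤ T) :
    S.HasGenerator (∫ s in (0 : ℝ)..T, S.op s.toNNReal x) (S.op T.toNNReal x - x) := by
  set f : ℝ → X := fun s => S.op s.toNNReal x with hf
  have hfc : Continuous f := (hc x).comp continuous_real_toNNReal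
  have hd : ∀ a : ℝ, Tendsto (fun t : ℝ≥0 => (t : ℝ)⁻¹ • ∫ s in a..(a + t), f s) (𝓝[>] 0)
      (𝓝 (f a)) := by
    intro a
    have h1 : HasDerivAt (fun u => ∫ s in a..u, f s) (f a) a :=
      intervalIntegral.integral_hasDerivAt_right (hfc.intervalIntegrable _ _)
        hfc.aestronglyMeasurable.stronglyMeasurableAtFilter hfc.continuousAt
    have h0 : Tendsto (fun t : ℝ≥0 => a + (t : ℝ)) (𝓝[>] 0) (𝓝[≠] a) := by
      refine tendsto_nhdsWithin_iff.2 ⟨?_, ?_⟩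
      · have : Continuous fun t : ℝ≥0 => a + (t : ℝ) := by fun_prop
        simpa using (this.tendsto 0).mono_left nhdsWithin_le_nhds
      · filter_upwards [self_mem_nhdsWithin] with s hs
        have : 0 < s := hs
        simp [this.ne']
    refine (h1.tendsto_slope.comp h0).congr fun t => ?_
    simp [slope]
  have h := (hd T).sub (hd 0)
  have hf0 : f 0 = x := by simp [hf, op_zero_apply]
  rw [hf0] at h
  refine h.congr fun t => ?_
  rw [← smul_sub]
  congr 1
  have hcomp : S.op t (∫ s in (0 : ℝ)..T, f s) = ∫ s in (0 : ℝ)..T, f (s + t) := by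
    rw [← ContinuousLinearMap.intervalIntegral_comp_comm _ (hfc.intervalIntegrable _ _)]
    refine intervalIntegral.integral_congr fun s hs => ?_
    rw [Set.uIcc_of_le hT] at hs
    simp only [hf]
    rw [← op_add_apply, Real.toNNReal_add hs.1 t.coe_nonneg, Real.toNNReal_coe, add_comm]
  have hi := fun a b => hfc.intervalIntegrable (μ := volume) a b
  have e1 := intervalIntegral.integral_add_adjacent_intervals (hi 0 T) (hi T (T + t))
  have e2 := intervalIntegral.integral_add_adjacent_intervals (hi 0 t) (hi t (T + t))
  rw [hcomp, intervalIntegral.integral_comp_add_right (fun s => f s)]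
  simp only [zero_add]
  rw [sub_eq_sub_iff_add_eq_add, add_comm (∫ s in T..(T + t), f s), e1, ← e2, add_comm]

/-- The averages t⁻¹ ∫₀ᵗ S_s x ds lie in the domain and converge to x. -/
theorem dense_generatorDomain [CompleteSpace X] (S : C0Semigroup X)
    (hc : ∀ x, Continuous fun t : ℝ≥0 => S.op t x) : Dense (S.generatorDomain : Set X) := by
  intro x
  set f : ℝ → X := fun s => S.op s.toNNReal x with hf
  have hfc : Continuous f := (hc x).comp continuous_real_toNNReal
  have h1 : HasDerivAt (fun u => ∫ s in (0 : ℝ)..u, f s) (f 0) 0 :=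
      intervalIntegral.integral_hasDerivAt_right (hfc.intervalIntegrable _ _)
        hfc.aestronglyMeasurable.stronglyMeasurableAtFilter hfc.continuousAt
  have hf0 : f 0 = x := by simp [hf, op_zero_apply]
  rw [hf0] at h1
  have h2 := h1.tendsto_slope.mono_left
    (nhdsWithin_mono (0 : ℝ) (t := {0}ᶜ) (s := Set.Ioi 0) (fun t ht => ne_of_gt ht))
  refine mem_closure_of_tendsto h2 ?_
  filter_upwards [self_mem_nhdsWithin] with t ht
  have ht : (0 : ℝ) < t := ht
  simp only [slope, vsub_eq_sub, intervalIntegral.integral_same, sub_zero]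
  exact S.generatorDomain.smul_mem _ (S.hasGenerator_integral hc x ht.le).mem

end C0Semigroup

/-! ### Resolvents of the generator -/

namespace C0Semigroup

section Resolvent

variable {X : Type*} [NormedAddCommGroup X] [NormedSpace ℝ X]

theorem HasGenerator.sub {S : C0Semigroup X} {x y x' y' : X} (h : S.HasGenerator x y)
    (h' : S.HasGenerator x' y') : S.HasGenerator (x - x') (y - y') := by
  refine (Tendsto.sub h h').congr fun t => ?_
  rw [← smul_sub, map_sub]
  congr 1
  abel

theorem HasGenerator.neg {S : C0Semigroup X} {x y : X} (h : S.HasGenerator x y) :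
    S.HasGenerator (-x) (-y) := by
  refine (Tendsto.neg h).congr fun t => ?_
  rw [← smul_neg, map_neg]
  congr 1
  abel

/-- `R` is the inverse of `l + G`, where `G` is the generator of `S`. -/
def IsResolvent (S : C0Semigroup X) (l : ℝ) (R : X →L[ℝ] X) : Prop :=
  (∀ x, S.HasGenerator (R x) (x - l • R x)) ∧ ∀ x y, S.HasGenerator x y → R (l • x + y) = x

theorem smulIdSub_apply {S : C0Semigroup X} {A : X →ₗ.[ℝ] X} (hA : -A = S.generator) (l : ℝ)
    {x y : X} (h : S.HasGenerator x y) (hx : x ∈ A.domain) :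
    A.smulIdSub l ⟨x, hx⟩ = l • x + y := by
  obtain rfl : A = -S.generator := by rw [← hA, neg_neg]
  have h1 : S.generator ⟨x, hx⟩ = y := h.generator_eq hx
  have h2 : (-S.generator).toFun ⟨x, hx⟩ = -y := by
    rw [← h1]; rfl
  simp [LinearPMap.smulIdSub, h2]

theorem mem_domain_iff {S : C0Semigroup X} {A : X →ₗ.[ℝ] X} (hA : -A = S.generator) {x : X} :
    x ∈ A.domain ↔ ∃ y, S.HasGenerator x y := by
  have : A.domain = S.generator.domain := by rw [← hA]; rfl
  rw [this]
  exact Iff.rfl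

theorem notMem_realSpectrum_iff {S : C0Semigroup X} {A : X →ₗ.[ℝ] X} (hA : -A = S.generator)
    (l : ℝ) : l ∉ A.realSpectrum ↔ ∃ R, S.IsResolvent l R := by
  simp only [LinearPMap.realSpectrum, Set.mem_ofPred_eq, not_not]
  refine exists_congr fun R => and_congr (forall_congr' fun x => ?_) ?_
  · constructor
    · rintro ⟨h, hx⟩
      obtain ⟨y, hy⟩ := (mem_domain_iff hA).1 h
      rw [smulIdSub_apply hA l hy h] at hx
      rwa [show y = x - l • R x from eq_sub_of_add_eq' hx] at hy
    · intro h
      refine ⟨(mem_domain_iff hA).2 ⟨_, h⟩, ?_⟩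
      rw [smulIdSub_apply hA l h]
      abel
  · constructor
    · intro h x y hxy
      have := h ⟨x, (mem_domain_iff hA).2 ⟨_, hxy⟩⟩
      rwa [smulIdSub_apply hA l hxy] at this
    · rintro h ⟨x, hx⟩
      obtain ⟨y, hy⟩ := (mem_domain_iff hA).1 hx
      rw [smulIdSub_apply hA l hy]
      exact h x y hy

end Resolvent

/-! ### Symmetric contraction semigroups: from norm convergence to decay and isolation of 0 -/

variable {H : Type*} [NormedAddCommGroup H] [InnerProductSpace ℝ H]

/-- A symmetric contraction semigroup together with the orthogonal projection `P` onto its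
fixed space. -/
structure IsErgodic (S : C0Semigroup H) (P : H →L[ℝ] H) : Prop where
  norm_le : ∀ t x, ‖S.op t x‖ ≤ ‖x‖
  symm : ∀ t x y, inner ℝ (S.op t x) y = inner ℝ x (S.op t y)
  proj_symm : ∀ x y, inner ℝ (P x) y = inner ℝ x (P y)
  proj_proj : ∀ x, P (P x) = P x
  op_proj : ∀ t x, S.op t (P x) = P x
  proj_op : ∀ t x, P (S.op t x) = P x
  proj_of_fixed : ∀ x, (∀ t, S.op t x = x) → P x = x

namespace IsErgodic

variable {S : C0Semigroup H} {P : H →L[ℝ] H}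

theorem continuous (h : IsErgodic S P) (x : H) : Continuous fun t => S.op t x :=
  S.continuous_op_apply h.norm_le x

theorem norm_sub_proj_sq (h : IsErgodic S P) (x : H) :
    ‖x - P x‖ ^ 2 = inner ℝ (x - P x) x := by
  rw [← real_inner_self_eq_norm_sq, inner_sub_right _ x, sub_eq_self, ← h.proj_symm, map_sub,
    h.proj_proj, sub_self, inner_zero_left]

theorem norm_sub_proj_le (h : IsErgodic S P) (x : H) : ‖x - P x‖ ≤ ‖x‖ := by
  have h1 := h.norm_sub_proj_sq x
  have h2 := real_inner_le_norm (x - P x) x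
  rcases (norm_nonneg (x - P x)).eq_or_lt with h0 | h0
  · rw [← h0]; exact norm_nonneg _
  · nlinarith

theorem op_sub_proj (h : IsErgodic S P) (t : ℝ≥0) (x : H) :
    S.op t x - P x = S.op t (x - P x) := by
  rw [map_sub, h.op_proj]

theorem sub_comp_sub (h : IsErgodic S P) (s t : ℝ≥0) (x : H) :
    (S.op s - P) ((S.op t - P) x) = (S.op (s + t) - P) x := by
  simp [h.op_proj, h.proj_op, h.proj_proj, op_add_apply]

theorem norm_sub_le_one (h : IsErgodic S P) (t : ℝ≥0) : ‖S.op t - P‖ ≤ 1 := by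
  refine ContinuousLinearMap.opNorm_le_bound _ zero_le_one fun x => ?_
  rw [one_mul, sub_apply, h.op_sub_proj]
  exact (h.norm_le _ _).trans (h.norm_sub_proj_le x)

theorem norm_sub_add_le (h : IsErgodic S P) (s t : ℝ≥0) :
    ‖S.op (s + t) - P‖ ≤ ‖S.op s - P‖ * ‖S.op t - P‖ := by
  have : S.op (s + t) - P = (S.op s - P).comp (S.op t - P) := by
    ext x; exact (h.sub_comp_sub s t x).symm
  rw [this]
  exact ContinuousLinearMap.opNorm_comp_le _ _

/-- S_t - P is symmetric with square S_{2t} - P, so ‖(S_t - P) x‖² = ⟨(S_{2t} - P) x, x⟩. -/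
theorem norm_sub_sq_le (h : IsErgodic S P) (t : ℝ≥0) :
    ‖S.op t - P‖ ^ 2 ≤ ‖S.op (t + t) - P‖ := by
  have h1 : ‖S.op t - P‖ ≤ √‖S.op (t + t) - P‖ := by
    refine ContinuousLinearMap.opNorm_le_bound _ (Real.sqrt_nonneg _) fun x => ?_
    refine (le_abs_self _).trans (abs_le_of_sq_le_sq ?_ (by positivity))
    have h2 : ‖(S.op t - P) x‖ ^ 2 = inner ℝ ((S.op (t + t) - P) x) x := by
      rw [← h.sub_comp_sub, ← real_inner_self_eq_norm_sq]
      simp only [sub_apply, inner_sub_left, inner_sub_right, h.symm, h.proj_symm, map_sub,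
        h.op_proj, h.proj_op]
    rw [h2, mul_pow, Real.sq_sqrt (norm_nonneg _), sq ‖x‖, ← mul_assoc]
    exact (real_inner_le_norm _ _).trans
      (mul_le_mul_of_nonneg_right (ContinuousLinearMap.le_opNorm _ _) (norm_nonneg _))
  calc ‖S.op t - P‖ ^ 2 ≤ √‖S.op (t + t) - P‖ ^ 2 := by gcongr
    _ = _ := Real.sq_sqrt (norm_nonneg _)

theorem exists_exp_bound (h : IsErgodic S P) (hlim : Tendsto (fun t => S.op t) atTop (𝓝 P)) :
    ∃ ε : ℝ, 0 < ε ∧ ∀ t : ℝ≥0, ‖S.op t - P‖ ≤ Real.exp (-(ε * t)) := by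
  have h0 : Tendsto (fun t => ‖S.op t - P‖) atTop (𝓝 0) :=
    tendsto_iff_norm_sub_tendsto_zero.1 hlim
  obtain ⟨t₀, ht₀, ht₀'⟩ := ((h0.eventually_lt_const (show (0 : ℝ) < Real.exp (-1) by
    positivity)).and (eventually_gt_atTop 0)).exists
  have hpos : (0 : ℝ) < t₀ := ht₀'
  -- The rate is chosen so that each step of length t₀ gains a factor e⁻¹.
  set ε : ℝ := 1 / t₀ with hε
  have hεt : ε * t₀ = 1 := by rw [hε]; field_simp
  have step : ∀ (N : ℕ) (r : ℝ≥0), ‖S.op (N * t₀ + r) - P‖ ≤ Real.exp (-N) := by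
    intro N r
    induction N with
    | zero => simpa using h.norm_sub_le_one r
    | succ n ih =>
      have e : ((n + 1 : ℕ) : ℝ≥0) * t₀ + r = t₀ + (n * t₀ + r) := by push_cast; ring
      rw [e]
      refine (h.norm_sub_add_le _ _).trans ?_
      refine (mul_le_mul ht₀.le ih (norm_nonneg _) (Real.exp_pos _).le).trans (le_of_eq ?_)
      rw [← Real.exp_add]; congr 1; push_cast; ring
  -- Rounding s / t₀ down to an integer costs at most a factor e.
  have all : ∀ s : ℝ≥0, ‖S.op s - P‖ ≤ Real.exp (-(ε * s) + 1) := by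
    intro s
    set N := ⌊s / t₀⌋₊ with hN
    have h1 : (N : ℝ≥0) * t₀ ≤ s := by
      rw [← le_div_iff₀ ht₀']; exact Nat.floor_le (by positivity)
    have h2 := step N (s - N * t₀)
    rw [add_tsub_cancel_of_le h1] at h2
    refine h2.trans (Real.exp_le_exp.2 ?_)
    have h3 : s / t₀ < (N : ℝ≥0) + 1 := Nat.lt_floor_add_one _
    have h4 : (s : ℝ) / t₀ < N + 1 := by exact_mod_cast h3
    have h5 : ε * s = (s : ℝ) / t₀ := by rw [hε]; ring
    linarith
  have pw : ∀ (n : ℕ) (t : ℝ≥0), ‖S.op t - P‖ ^ 2 ^ n ≤ ‖S.op (2 ^ n * t) - P‖ := by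
    intro n
    induction n with
    | zero => intro t; simp
    | succ n ih =>
      intro t
      rw [pow_succ, pow_mul]
      calc (‖S.op t - P‖ ^ 2 ^ n) ^ 2 ≤ ‖S.op (2 ^ n * t) - P‖ ^ 2 := by gcongr; exact ih t
        _ ≤ _ := h.norm_sub_sq_le _
        _ = _ := by congr 3; ring
  refine ⟨ε, by positivity, fun t => ?_⟩
  -- Taking the 2ⁿ-th root of the bound at time 2ⁿ t turns the superfluous factor e into e^{1/2ⁿ},
  -- which tends to 1.
  have bd : ∀ n : ℕ, ‖S.op t - P‖ ≤ Real.exp (-(ε * t) + (1 / 2) ^ n) := by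
    intro n
    have h1 := (pw n t).trans (all _)
    rw [← pow_le_pow_iff_left₀ (norm_nonneg _) (Real.exp_pos _).le (n := 2 ^ n) (by positivity),
      ← Real.exp_nat_mul]
    refine h1.trans (le_of_eq ?_)
    congr 1
    push_cast
    rw [mul_add, ← mul_pow]
    norm_num
    ring
  have lim : Tendsto (fun n : ℕ => Real.exp (-(ε * t) + (1 / 2) ^ n)) atTop
      (𝓝 (Real.exp (-(ε * t) + 0))) :=
    (Real.continuous_exp.tendsto _).comp
      ((tendsto_pow_atTop_nhds_zero_of_lt_one (by norm_num) (by norm_num)).const_add _)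
  rw [add_zero] at lim
  exact ge_of_tendsto' lim bd

end IsErgodic

/-- The operator `x ↦ ∫₀¹ e^{ls} S_s x ds` maps into the domain of the generator. -/
theorem exists_integral_rescale [CompleteSpace H] (S : C0Semigroup H)
    (hS : ∀ t x, ‖S.op t x‖ ≤ ‖x‖) (l : ℝ) :
    ∃ V : H →L[ℝ] H, ∀ x, S.HasGenerator (V x) (Real.exp l • S.op 1 x - x - l • V x) := by
  have hc : ∀ x, Continuous fun t => (S.rescale l).op t x := fun x => by
    have := S.continuous_op_apply hS x
    simp only [rescale_op]
    fun_prop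
  have hi : ∀ x, IntervalIntegrable (fun s : ℝ => (S.rescale l).op s.toNNReal x) volume 0 1 :=
    fun x => ((hc x).comp continuous_real_toNNReal).intervalIntegrable _ _
  refine ⟨LinearMap.mkContinuous
    { toFun := fun x => ∫ s in (0 : ℝ)..1, (S.rescale l).op s.toNNReal x
      map_add' := fun x y => by
        rw [← intervalIntegral.integral_add (hi x) (hi y)]; simp
      map_smul' := fun c x => by
        rw [← intervalIntegral.integral_smul]; simp } (Real.exp |l|) ?_, ?_⟩
  · intro x
    have := intervalIntegral.norm_integral_le_of_norm_le_const (a := 0) (b := 1)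
      (C := Real.exp |l| * ‖x‖) (f := fun s : ℝ => (S.rescale l).op s.toNNReal x) ?_
    · simpa using this
    · intro s hs
      rw [Set.uIoc_of_le zero_le_one] at hs
      rw [rescale_op, norm_smul, Real.norm_eq_abs, Real.abs_exp, Real.coe_toNNReal _ hs.1.le]
      refine mul_le_mul (Real.exp_le_exp.2 ?_) (hS _ _) (norm_nonneg _) (Real.exp_pos _).le
      calc l * s ≤ |l * s| := le_abs_self _
        _ = |l| * s := by rw [abs_mul, abs_of_pos hs.1]
        _ ≤ |l| * 1 := by gcongr; exact hs.2
        _ = |l| := mul_one _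
  · intro x
    have := (hasGenerator_integral (S.rescale l) hc x zero_le_one).of_rescale
    simpa [rescale_op] using this

/-- An element of `ker (l + G)` is an eigenvector of the semigroup. -/
theorem HasGenerator.exp_smul_op_eq {S : C0Semigroup H} (hS : ∀ t x, ‖S.op t x‖ ≤ ‖x‖) {l : ℝ}
    {u : H} (hu : S.HasGenerator u (-(l • u))) (t : ℝ≥0) : Real.exp (l * t) • S.op t u = u := by
  have hc : Continuous fun t : ℝ => Real.exp (l * t) • S.op t.toNNReal u := by
    have := (S.continuous_op_apply hS u).comp continuous_real_toNNReal
    simp only [Function.comp_def] at this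
    fun_prop
  have := constant_of_has_deriv_right_zero (a := 0) (b := t) hc.continuousOn ?_ t
    ⟨t.coe_nonneg, le_rfl⟩
  · simpa [op_zero_apply] using this
  · intro s hs
    have h1 := S.hasDerivWithinAt_op hu hs.1
    have h2 : HasDerivWithinAt (fun s : ℝ => Real.exp (l * s)) (Real.exp (l * s) * l)
        (Set.Ici s) s := by
      have := ((hasDerivAt_id s).const_mul l).exp
      simpa using this.hasDerivWithinAt
    have h3 := h2.smul h1
    refine h3.congr_deriv ?_
    rw [map_neg, map_smul, smul_neg, smul_smul, neg_add_cancel]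

namespace IsErgodic

variable {S : C0Semigroup H} {P : H →L[ℝ] H}

theorem exists_isResolvent [CompleteSpace H] (h : IsErgodic S P) {ε : ℝ}
    (hε : ∀ t : ℝ≥0, 0 < t → ‖S.op t - P‖ ≤ Real.exp (-(ε * t))) {l : ℝ} (hl : l ≠ 0)
    (hlε : l < ε) : ∃ R, S.IsResolvent l R := by
  obtain ⟨V, hV⟩ := exists_integral_rescale S h.norm_le l
  have hu : IsUnit (1 - Real.exp l • S.op 1) := by
    -- The cross term vanishes because (S_1 - P) P = 0. The first factor is inverted by a Neumann
    -- series, as l < ε; the second, on multiples of P, because e^l ≠ 1.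
    have e : 1 - Real.exp l • S.op 1 =
        (1 - Real.exp l • (S.op 1 - P)) * (1 - Real.exp l • P) := by
      ext x
      simp [h.op_proj, h.proj_proj, smul_sub]
    rw [e]
    refine IsUnit.mul (isUnit_one_sub_of_norm_lt_one ?_) ?_
    · rw [norm_smul, Real.norm_eq_abs, Real.abs_exp]
      calc Real.exp l * ‖S.op 1 - P‖ ≤ Real.exp l * Real.exp (-(ε * (1 : ℝ≥0))) := by
            gcongr; exact hε 1 one_pos
        _ = Real.exp (l - ε) := by rw [← Real.exp_add]; congr 1; push_cast; ring
        _ < 1 := by rw [Real.exp_lt_one_iff]; linarith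
    · have hne : 1 - Real.exp l ≠ 0 := by
        rw [sub_ne_zero, ne_comm, Ne, Real.exp_eq_one_iff]; exact hl
      set a := Real.exp l
      -- Solves (1 - aP)(1 + bP) = 1 for P² = P.
      set b := a / (1 - a) with hb
      have key : b - a - a * b = 0 := by
        rw [hb]; field_simp; ring
      refine ⟨⟨1 - a • P, 1 + b • P, ?_, ?_⟩, rfl⟩
      all_goals
        ext x
        simp only [mul_apply_eq_comp, sub_apply, add_apply, smul_apply, one_apply_eq_self, map_add,
          map_sub, map_smul, h.proj_proj]
        linear_combination (norm := module) key • P x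
  obtain ⟨⟨D, D', h1, h2⟩, hD : D = _⟩ := hu
  have h1' : ∀ x, D (D' x) = x := fun x => by
    rw [← mul_apply_eq_comp, h1]; rfl
  have h2' : ∀ x, D' (D x) = x := fun x => by
    rw [← mul_apply_eq_comp, h2]; rfl
  have hDx : ∀ x, D x = x - Real.exp l • S.op 1 x := fun x => by rw [hD]; simp
  -- (l + G) V = e^l S_1 - I = -D, so -V D⁻¹ is a right inverse of l + G.
  have hgen : ∀ x, S.HasGenerator (-(V (D' x))) (x - l • -(V (D' x))) := by
    intro x
    have h3 := (hV (D' x)).neg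
    have h4 := h1' x
    rw [hDx] at h4
    convert h3 using 1
    rw [smul_neg]
    nth_rewrite 1 [← h4]
    abel
  refine ⟨-(V.comp D'), hgen, fun x y hxy => ?_⟩
  -- Injectivity of l + G: an element of its kernel is fixed by e^l S_1, hence is annihilated by the
  -- invertible D.
  set w := l • x + y with hw
  have h5 := (hgen w).sub hxy
  have h6 : w - l • -(V (D' w)) - y = -(l • (-(V (D' w)) - x)) := by
    rw [hw, smul_sub]; abel
  rw [h6] at h5
  have h7 := h5.exp_smul_op_eq h.norm_le 1
  have h8 : D (-(V (D' w)) - x) = 0 := by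
    rw [hDx, sub_eq_zero]
    simpa using h7.symm
  have h9 := h2' (-(V (D' w)) - x)
  rw [h8, map_zero, eq_comm, sub_eq_zero] at h9
  exact h9

theorem notMem_essSpectrum [CompleteSpace H] (h : IsErgodic S P) (hP : FiniteDimensional ℝ P.range)
    {A : H →ₗ.[ℝ] H} (hA : -A = S.generator) {ε : ℝ} (hε0 : 0 < ε)
    (hε : ∀ t : ℝ≥0, 0 < t → ‖S.op t - P‖ ≤ Real.exp (-(ε * t))) : 0 ∉ A.essSpectrum := by
  simp only [LinearPMap.essSpectrum, Set.mem_ofPred_eq, not_or, not_not]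
  constructor
  · rw [accPt_iff_frequently, not_frequently]
    filter_upwards [Iio_mem_nhds hε0] with l hl
    rintro ⟨hl0, hmem⟩
    exact (notMem_realSpectrum_iff hA l).2 (h.exists_isResolvent hε hl0 hl) hmem
  -- Elements of ker A are fixed by S, so they lie in the range of P.
  · have hx : ∀ x : LinearMap.ker (A.smulIdSub 0), P (x : A.domain) = ((x : A.domain) : H) := by
      rintro ⟨⟨x, hx⟩, hx0⟩
      obtain ⟨y, hy⟩ := (mem_domain_iff hA).1 hx
      rw [LinearMap.mem_ker, smulIdSub_apply hA 0 hy hx, zero_smul, zero_add] at hx0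
      rw [hx0] at hy
      refine h.proj_of_fixed x fun t => ?_
      have : S.HasGenerator x (-((0 : ℝ) • x)) := by simpa using hy
      simpa using this.exp_smul_op_eq h.norm_le t
    let f : LinearMap.ker (A.smulIdSub 0) →ₗ[ℝ] P.range :=
      ((A.domain.subtype).comp (LinearMap.ker (A.smulIdSub 0)).subtype).codRestrict P.range
        fun x => ⟨(x : A.domain), hx x⟩
    refine FiniteDimensional.of_injective f fun x y hxy => ?_
    have := congrArg Subtype.val hxy
    exact Subtype.ext (Subtype.ext this)

end IsErgodic
end C0Semigroup

/-! ### From a spectral gap to exponential decay -/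

theorem le_of_hasDerivWithinAt_nonpos {f f' : ℝ → ℝ} (hf : Continuous f)
    (hf' : ∀ x, 0 ≤ x → HasDerivWithinAt f (f' x) (Set.Ici x) x) (hn : ∀ x, 0 ≤ x → f' x ≤ 0)
    {a b : ℝ} (ha : 0 ≤ a) (hab : a ≤ b) : f b ≤ f a :=
  image_le_of_deriv_right_le_deriv_boundary (B := fun _ => f a) (B' := fun _ => 0)
    hf.continuousOn (fun x hx => hf' x (ha.trans hx.1)) le_rfl continuousOn_const
    (fun _ _ => hasDerivWithinAt_const _ _ _) (fun x hx => hn x (ha.trans hx.1)) ⟨hab, le_rfl⟩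

namespace C0Semigroup.IsErgodic

variable {H : Type*} [NormedAddCommGroup H] [InnerProductSpace ℝ H]
variable {S : C0Semigroup H} {P : H →L[ℝ] H}

theorem inner_op_add (h : IsErgodic S P) (s t : ℝ≥0) (x y : H) :
    inner ℝ (S.op (s + t) x) y = inner ℝ (S.op s x) (S.op t y) := by
  rw [add_comm, op_add_apply, h.symm]

theorem inner_op_self (h : IsErgodic S P) (t : ℝ≥0) (x : H) :
    inner ℝ (S.op t x) x = ‖S.op (t / 2) x‖ ^ 2 := by
  rw [← real_inner_self_eq_norm_sq, ← h.inner_op_add, add_halves]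

theorem inner_symm_of_hasGenerator (h : IsErgodic S P) {x y x' y' : H} (hx : S.HasGenerator x y)
    (hx' : S.HasGenerator x' y') : inner ℝ y x' = inner ℝ x y' := by
  have h1 := Filter.Tendsto.inner (𝕜 := ℝ) hx (tendsto_const_nhds (x := x'))
  have h2 := Filter.Tendsto.inner (𝕜 := ℝ) (tendsto_const_nhds (x := x)) hx'
  refine tendsto_nhds_unique h1 (h2.congr fun t => ?_)
  simp only [inner_smul_left, inner_smul_right, inner_sub_left, inner_sub_right, h.symm]
  rfl

/-- If `(0, 2c)` is contained in the resolvent set, the resolvent at `c` has norm at most `1/c`. -/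
theorem norm_resolvent_le (h : IsErgodic S P) {c : ℝ} (hc : 0 < c)
    (hres : ∀ l, 0 < l → l < 2 * c → ∃ R, S.IsResolvent l R) {K : H →L[ℝ] H}
    (hK : S.IsResolvent c K) : ‖K‖ ≤ 1 / c := by
  by_contra! hlt
  set k := ‖K‖ with hk
  have hk0 : 0 < k := lt_trans (by positivity) hlt
  -- If k > 1/c, both c + 1/k and c - 1/k lie in (0, 2c). Their resolvents bound ‖Kz‖ by a multiple
  -- of ‖z ± Kz/k‖, which nearly norm-attaining vectors will contradict.
  have hkc : 1 / k < c := by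
    rw [div_lt_iff₀ hc] at hlt
    rw [div_lt_iff₀ hk0]; linarith
  have hkp : 0 < 1 / k := by positivity
  have hsymm : ∀ x y, inner ℝ (K x) y = inner ℝ x (K y) := by
    intro x y
    have := h.inner_symm_of_hasGenerator (hK.1 x) (hK.1 y)
    rw [inner_sub_left, inner_sub_right, inner_smul_left, inner_smul_right] at this
    simp only [RCLike.conj_to_real] at this
    linarith
  obtain ⟨R₁, hR₁⟩ := hres (c + 1 / k) (by linarith) (by linarith)
  obtain ⟨R₂, hR₂⟩ := hres (c - 1 / k) (by linarith) (by linarith)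
  set M := max ‖R₁‖ ‖R₂‖ with hM
  have hM0 : 0 ≤ M := le_max_of_le_left (norm_nonneg _)
  have b₁ : ∀ z, ‖K z‖ ≤ M * ‖z + (1 / k) • K z‖ := by
    intro z
    have := hR₁.2 _ _ (hK.1 z)
    rw [show (c + 1 / k) • K z + (z - c • K z) = z + (1 / k) • K z by module] at this
    conv_lhs => rw [← this]
    exact (R₁.le_opNorm _).trans (by gcongr; exact le_max_left _ _)
  have b₂ : ∀ z, ‖K z‖ ≤ M * ‖z - (1 / k) • K z‖ := by
    intro z
    have := hR₂.2 _ _ (hK.1 z)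
    rw [show (c - 1 / k) • K z + (z - c • K z) = z - (1 / k) • K z by module] at this
    conv_lhs => rw [← this]
    exact (R₂.le_opNorm _).trans (by gcongr; exact le_max_right _ _)
  set N := (M / k) ^ 2 with hN
  have b₃ : ∀ x, ‖K (K x)‖ ≤ N * ‖k ^ 2 • x - K (K x)‖ := by
    intro x
    have h1 := b₂ (K x)
    have h2 := b₁ (k • x - K x)
    have e1 : K (k • x - K x) = k • (K x - (1 / k) • K (K x)) := by
      rw [map_sub, map_smul, smul_sub, smul_smul, mul_one_div_cancel hk0.ne', one_smul]
    have e2 : k • x - K x + (1 / k) • K (k • x - K x) = (1 / k) • (k ^ 2 • x - K (K x)) := by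
      rw [map_sub, map_smul, smul_sub, smul_sub, smul_smul, smul_smul,
        one_div_mul_cancel hk0.ne', one_smul, show 1 / k * k ^ 2 = k by field_simp]
      abel
    rw [e2, e1, norm_smul, norm_smul, Real.norm_of_nonneg hk0.le, Real.norm_of_nonneg hkp.le] at h2
    have h3 : ‖K x - (1 / k) • K (K x)‖ ≤ M / k ^ 2 * ‖k ^ 2 • x - K (K x)‖ := by
      rw [← le_div_iff₀' hk0] at h2
      refine h2.trans (le_of_eq ?_)
      field_simp
    refine h1.trans ((mul_le_mul_of_nonneg_left h3 hM0).trans (le_of_eq ?_))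
    rw [hN]
    ring
  -- Symmetry gives ‖Kx‖² = ⟨K²x, x⟩. Expanding ‖k²x - K²x‖² shows that it is small when ‖Kx‖ is
  -- close to k, while ‖K²x‖ stays away from 0.
  have b₄ : ∀ x, ‖x‖ < 1 → ‖K x‖ ^ 4 ≤ N ^ 2 * (k ^ 2 * (k ^ 2 - ‖K x‖ ^ 2)) := by
    intro x hx
    have h1 : ‖K x‖ ^ 2 = inner ℝ (K (K x)) x := by rw [hsymm, real_inner_self_eq_norm_sq]
    have h2 : ‖K x‖ ^ 2 ≤ ‖K (K x)‖ := by
      rw [h1]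
      exact (real_inner_le_norm _ _).trans (mul_le_of_le_one_right (norm_nonneg _) hx.le)
    have h3 : ‖k ^ 2 • x - K (K x)‖ ^ 2 ≤ k ^ 2 * (k ^ 2 - ‖K x‖ ^ 2) := by
      rw [norm_sub_sq_real, inner_smul_left, real_inner_comm, ← h1, norm_smul,
        Real.norm_of_nonneg (by positivity)]
      simp only [RCLike.conj_to_real]
      have h4 : ‖K (K x)‖ ^ 2 ≤ (k * ‖K x‖) ^ 2 := by gcongr; exact K.le_opNorm _
      have h5 : (k ^ 2 * ‖x‖) ^ 2 ≤ (k ^ 2 * 1) ^ 2 := by gcongr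
      nlinarith
    calc ‖K x‖ ^ 4 = (‖K x‖ ^ 2) ^ 2 := by ring
      _ ≤ (N * ‖k ^ 2 • x - K (K x)‖) ^ 2 := by gcongr; exact h2.trans (b₃ x)
      _ = N ^ 2 * ‖k ^ 2 • x - K (K x)‖ ^ 2 := by ring
      _ ≤ _ := by gcongr
  have hlim : Tendsto (fun r : ℝ => N ^ 2 * (k ^ 2 * (k ^ 2 - r ^ 2)) - r ^ 4) (𝓝[<] k)
      (𝓝 (N ^ 2 * (k ^ 2 * (k ^ 2 - k ^ 2)) - k ^ 4)) := by
    have : Continuous fun r : ℝ => N ^ 2 * (k ^ 2 * (k ^ 2 - r ^ 2)) - r ^ 4 := by fun_prop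
    exact (this.tendsto k).mono_left nhdsWithin_le_nhds
  have hneg : N ^ 2 * (k ^ 2 * (k ^ 2 - k ^ 2)) - k ^ 4 < 0 := by
    rw [sub_self, mul_zero, mul_zero, zero_sub]
    exact neg_neg_of_pos (by positivity)
  obtain ⟨r, ⟨hr, hrk⟩, hr0⟩ := (((hlim.eventually_lt_const hneg).and self_mem_nhdsWithin).and
    (mem_nhdsWithin_of_mem_nhds (Ioi_mem_nhds hk0))).exists
  obtain ⟨x, hx1, hx2⟩ := K.exists_lt_apply_of_lt_opNorm (show r < ‖K‖ from hrk)
  have h1 := b₄ x hx1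
  have hr0 : 0 < r := hr0
  have h2 : r ^ 4 ≤ ‖K x‖ ^ 4 := by gcongr
  have h3 : r ^ 2 ≤ ‖K x‖ ^ 2 := by gcongr
  have h4 : N ^ 2 * (k ^ 2 * (k ^ 2 - ‖K x‖ ^ 2)) ≤ N ^ 2 * (k ^ 2 * (k ^ 2 - r ^ 2)) := by gcongr
  linarith

/-- Since u = K(cu + y), the resolvent bound says c‖u‖ ≤ ‖cu + y‖; squaring gives the claim. In
terms of A it is the form version of λ² ≥ 2cλ, which fails exactly for λ in (0, 2c). -/
theorem gap (h : IsErgodic S P) {c : ℝ} (hc : 0 < c)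
    (hres : ∀ l, 0 < l → l < 2 * c → ∃ R, S.IsResolvent l R) {u y : H}
    (hu : S.HasGenerator u y) : -(2 * c * inner ℝ y u) ≤ ‖y‖ ^ 2 := by
  obtain ⟨K, hK⟩ := hres c hc (by linarith)
  have h1 : c * ‖u‖ ≤ ‖c • u + y‖ := by
    have := (K.le_opNorm (c • u + y)).trans
      (mul_le_mul_of_nonneg_right (h.norm_resolvent_le hc hres hK) (norm_nonneg _))
    rw [hK.2 _ _ hu, one_div, ← div_eq_inv_mul, le_div_iff₀ hc] at this
    linarith
  have h2 : (c * ‖u‖) ^ 2 ≤ ‖c • u + y‖ ^ 2 := by gcongr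
  rw [norm_add_sq_real, norm_smul, Real.norm_of_nonneg hc.le, inner_smul_left,
    real_inner_comm] at h2
  simp only [RCLike.conj_to_real] at h2
  linarith

/-- ⟨S_t u, u⟩ = ‖S_{t/2} u‖² decreases and is nonnegative, hence converges. By symmetry it controls
the distances ‖S_s u - S_t u‖, so the orbit is Cauchy; its limit is fixed and has the same
projection as u. -/
theorem tendsto_op_apply [CompleteSpace H] (h : IsErgodic S P) (u : H) :
    Tendsto (fun t => S.op t u) atTop (𝓝 (P u)) := by
  set g : ℝ≥0 → ℝ := fun t => inner ℝ (S.op t u) u with hg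
  have hanti : Antitone g := by
    intro s t hst
    simp only [hg, h.inner_op_self]
    have : t / 2 = (t - s) / 2 + s / 2 := by rw [← add_div, tsub_add_cancel_of_le hst]
    rw [this, op_add_apply]
    gcongr
    exact h.norm_le _ _
  have hlim : Tendsto g atTop (𝓝 (⨅ t, g t)) := tendsto_atTop_ciInf hanti
    ⟨0, by rintro _ ⟨t, rfl⟩; simp only [hg, h.inner_op_self]; positivity⟩
  set L := ⨅ t, g t
  have hdist : ∀ s t, ‖S.op s u - S.op t u‖ ^ 2 = g (s + s) - 2 * g (s + t) + g (t + t) := by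
    intro s t
    rw [norm_sub_sq_real, ← real_inner_self_eq_norm_sq, ← real_inner_self_eq_norm_sq]
    simp only [hg, h.inner_op_add]
  have hcauchy : CauchySeq fun t => S.op t u := by
    rw [Metric.cauchySeq_iff]
    intro ε hε
    obtain ⟨N, hN⟩ := eventually_atTop.1
      (hlim.eventually (Metric.ball_mem_nhds L (show 0 < ε ^ 2 / 4 by positivity)))
    refine ⟨N, fun s hs t ht => ?_⟩
    have h1 := abs_lt.1 (hN (s + s) (le_add_right hs))
    have h2 := abs_lt.1 (hN (s + t) (le_add_right hs))
    have h3 := abs_lt.1 (hN (t + t) (le_add_right ht))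
    rw [dist_eq_norm]
    refine lt_of_pow_lt_pow_left₀ 2 hε.le ?_
    rw [hdist]
    linarith [h1.1, h1.2, h2.1, h2.2, h3.1, h3.2]
  obtain ⟨w, hw⟩ := cauchySeq_tendsto_of_complete hcauchy
  have hfix : ∀ s, S.op s w = w := by
    intro s
    have h1 := ((S.op s).continuous.tendsto w).comp hw
    have h2 := hw.comp (tendsto_atTop_mono (fun t => le_add_of_nonneg_left s.2) tendsto_id)
    refine tendsto_nhds_unique h1 (h2.congr fun t => ?_)
    exact S.op_add_apply s t u
  have hPw : P w = P u := by
    have h1 := (P.continuous.tendsto w).comp hw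
    refine tendsto_nhds_unique h1 (tendsto_const_nhds.congr fun t => ?_)
    simp [h.proj_op]
  rwa [← hPw, h.proj_of_fixed w hfix]

/-- With g(t) = ⟨S_t u - Pu, u⟩ and e = -g', the gap inequality at S_{t/2} u reads εe ≤ -e'. So e -
εg decreases; its limit at infinity is 0, hence g' ≤ -εg. Finally g(2t) = ‖S_t u - Pu‖². -/
theorem norm_op_sub_le_of_gap [CompleteSpace H] (h : IsErgodic S P) {ε : ℝ}
    (hgap : ∀ {u y : H}, S.HasGenerator u y → -(ε * inner ℝ y u) ≤ ‖y‖ ^ 2)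
    {u y : H} (hu : S.HasGenerator u y) (t : ℝ≥0) :
    ‖S.op t u - P u‖ ≤ Real.exp (-(ε * t)) * ‖u‖ := by
  have hcu : Continuous fun t : ℝ => S.op t.toNNReal u :=
    (h.continuous u).comp continuous_real_toNNReal
  have hPy : P y = 0 := by
    have h1 := (P.continuous.tendsto y).comp hu
    refine tendsto_nhds_unique h1 (tendsto_const_nhds.congr fun t => ?_)
    simp [h.proj_op]
  set g : ℝ → ℝ := fun t => inner ℝ (S.op t.toNNReal u - P u) u with hg
  set e : ℝ → ℝ := fun t => -inner ℝ (S.op t.toNNReal u) y with he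
  have hgc : Continuous g := by fun_prop
  have hec : Continuous e := by fun_prop
  have hgd : ∀ t, 0 ≤ t → HasDerivWithinAt g (-e t) (Set.Ici t) t := by
    intro t ht
    have := ((S.hasDerivWithinAt_op hu ht).sub_const (P u)).inner ℝ
      (hasDerivWithinAt_const t (Set.Ici t) u)
    refine this.congr_deriv ?_
    rw [inner_zero_right, zero_add, he, neg_neg, h.symm, real_inner_comm]
  have hed : ∀ t, 0 ≤ t → HasDerivWithinAt e (-inner ℝ (S.op t.toNNReal y) y) (Set.Ici t) t := by
    intro t ht
    have := ((S.hasDerivWithinAt_op hu ht).inner ℝ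
      (hasDerivWithinAt_const t (Set.Ici t) y)).neg
    refine this.congr_deriv ?_
    rw [inner_zero_right, zero_add]
  have hgape : ∀ t, ε * e t ≤ inner ℝ (S.op t.toNNReal y) y := by
    intro t
    have h1 := hgap (hu.op (t.toNNReal / 2))
    rw [← h.inner_op_self, ← h.inner_op_add, add_halves, h.symm, real_inner_comm] at h1
    simp only [he]
    linarith
  have hge : ∀ t, 0 ≤ t → ε * g t ≤ e t := by
    intro t ht
    have hmono : ∀ s, t ≤ s → e s - ε * g s ≤ e t - ε * g t := fun s hs =>
      le_of_hasDerivWithinAt_nonpos (f := fun s => e s - ε * g s) (by fun_prop)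
        (fun x hx => (hed x hx).sub ((hgd x hx).const_mul ε))
        (fun x _ => by linarith [hgape x]) ht hs
    have hop : Tendsto (fun s : ℝ => S.op s.toNNReal u) atTop (𝓝 (P u)) :=
      (h.tendsto_op_apply u).comp Real.tendsto_toNNReal_atTop
    have hlim : Tendsto (fun s => e s - ε * g s) atTop
        (𝓝 (-inner ℝ (P u) y - ε * inner ℝ (P u - P u) u)) :=
      ((hop.inner tendsto_const_nhds).neg).sub
        (((hop.sub_const _).inner tendsto_const_nhds).const_mul _)
    rw [h.proj_symm, hPy, sub_self, inner_zero_right, inner_zero_left, mul_zero, neg_zero,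
      sub_zero] at hlim
    have := le_of_tendsto hlim ((eventually_ge_atTop t).mono hmono)
    linarith
  have hdecay : ∀ t, 0 ≤ t → Real.exp (ε * t) * g t ≤ g 0 := by
    intro t ht
    have := le_of_hasDerivWithinAt_nonpos (f := fun s => Real.exp (ε * s) * g s) (by fun_prop)
        (fun x hx => HasDerivWithinAt.mul
          (((hasDerivAt_id x).const_mul ε).exp.hasDerivWithinAt) (hgd x hx))
        (fun x hx => by
          have := mul_nonneg (Real.exp_pos (ε * x)).le (sub_nonneg.2 (hge x hx))
          simp only [id]
          linarith) le_rfl ht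
    simpa using this
  have h0 : g 0 ≤ ‖u‖ ^ 2 := by
    simp only [hg, Real.toNNReal_zero, op_zero_apply]
    rw [← h.norm_sub_proj_sq]
    gcongr
    exact h.norm_sub_proj_le u
  have h2t : ‖S.op t u - P u‖ ^ 2 = g (t + t) := by
    have : (t + t : ℝ).toNNReal = t + t := by
      rw [← NNReal.coe_add, Real.toNNReal_coe]
    rw [← real_inner_self_eq_norm_sq]
    simp only [hg, this, inner_sub_left, inner_sub_right, h.inner_op_add, h.proj_symm, h.proj_op,
      h.proj_proj]
    rw [h.symm t u (P u), h.op_proj]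
    ring
  refine le_of_sq_le_sq ?_ (by positivity)
  have h1 := hdecay (t + t) (by positivity)
  rw [h2t, mul_pow, ← Real.exp_nat_mul]
  rw [← le_div_iff₀' (Real.exp_pos _), div_eq_inv_mul, ← Real.exp_neg] at h1
  refine h1.trans ?_
  rw [show ((2 : ℕ) : ℝ) * -(ε * t) = -(ε * (t + t)) by push_cast; ring]
  gcongr

theorem exists_exp_bound_of_notMem_essSpectrum [CompleteSpace H] (h : IsErgodic S P)
    {A : H →ₗ.[ℝ] H} (hA : -A = S.generator) (h0 : 0 ∉ A.essSpectrum) :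
    ∃ ε : ℝ, 0 < ε ∧ ∀ t : ℝ≥0, ‖S.op t - P‖ ≤ Real.exp (-(ε * t)) := by
  simp only [LinearPMap.essSpectrum, Set.mem_ofPred_eq, not_or, accPt_iff_frequently,
    not_frequently] at h0
  obtain ⟨ε, hε, hball⟩ := Metric.eventually_nhds_iff.1 h0.1
  have hres : ∀ l, 0 < l → l < 2 * (ε / 2) → ∃ R, S.IsResolvent l R := by
    intro l hl hlε
    rw [← notMem_realSpectrum_iff hA]
    intro hmem
    refine hball (y := l) ?_ ⟨hl.ne', hmem⟩
    rw [Real.dist_eq, sub_zero, abs_of_pos hl]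
    linarith
  refine ⟨ε, hε, fun t => ContinuousLinearMap.opNorm_le_bound _ (Real.exp_pos _).le fun x => ?_⟩
  have hd := S.dense_generatorDomain h.continuous
  refine hd.induction (P := fun x => ‖(S.op t - P) x‖ ≤ Real.exp (-(ε * t)) * ‖x‖) ?_ ?_ x
  · rintro u ⟨y, hy⟩
    refine h.norm_op_sub_le_of_gap (fun hu => ?_) hy t
    have := h.gap (half_pos hε) hres hu
    rwa [mul_div_cancel₀ _ two_ne_zero] at this
  · exact isClosed_le (by fun_prop) (by fun_prop)

theorem tfae [CompleteSpace H] (h : IsErgodic S P) (hP : FiniteDimensional ℝ P.range)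
    {A : H →ₗ.[ℝ] H} (hA : -A = S.generator) :
    [ (0 : ℝ) ∉ A.essSpectrum,
      Tendsto (fun t : ℝ≥0 => S.op t) atTop (𝓝 P),
      ∃ ε : ℝ, 0 < ε ∧ ∀ t : ℝ≥0, 0 < t → ‖S.op t - P‖ ≤ Real.exp (-(ε * (t : ℝ))) ].TFAE := by
  tfae_have 1 → 3 := fun h0 => by
    obtain ⟨ε, hε, hb⟩ := h.exists_exp_bound_of_notMem_essSpectrum hA h0
    exact ⟨ε, hε, fun t _ => hb t⟩
  tfae_have 2 → 3 := fun h0 => by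
    obtain ⟨ε, hε, hb⟩ := h.exists_exp_bound h0
    exact ⟨ε, hε, fun t _ => hb t⟩
  tfae_have 3 → 2 := by
    rintro ⟨ε, hε, hb⟩
    rw [tendsto_iff_norm_sub_tendsto_zero]
    refine squeeze_zero' (Eventually.of_forall fun _ => norm_nonneg _)
      ((eventually_gt_atTop 0).mono hb) ?_
    refine Real.tendsto_exp_neg_atTop_nhds_zero.comp ?_
    exact NNReal.tendsto_coe_atTop.2 tendsto_id |>.const_mul_atTop hε
  tfae_have 3 → 1 := by
    rintro ⟨ε, hε, hb⟩
    exact h.notMem_essSpectrum hP hA hε hb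
  tfae_finish

end C0Semigroup.IsErgodic

/-! ### Markov operators: order, Jensen's inequality, contractivity in L_p -/

variable {Γ : Type*} [MeasurableSpace Γ] {μ : Measure Γ} [IsFiniteMeasure μ]

theorem lp_const_eq_smul {p : ℝ≥0∞} (c : ℝ) :
    Lp.const p μ c = c • Lp.const p μ (1 : ℝ) := by
  have := (Lp.constₗ p μ ℝ : ℝ →ₗ[ℝ] Lp ℝ p μ).map_smul c 1
  simpa using this

theorem integral_lp_const {p : ℝ≥0∞} (c : ℝ) : ∫ x, Lp.const p μ c x ∂μ = μ.real Set.univ * c := by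
  rw [integral_congr_ae (Lp.coeFn_const p μ c)]
  simp

theorem inner_lp_const_one (f : Lp ℝ 2 μ) : inner ℝ (Lp.const 2 μ (1 : ℝ)) f = ∫ x, f x ∂μ := by
  rw [L2.inner_def]
  refine integral_congr_ae ?_
  filter_upwards [Lp.coeFn_const 2 μ (1 : ℝ)] with x hx
  rw [hx]
  simp

theorem meanProj_two_apply (f : Lp ℝ 2 μ) :
    meanProj μ 2 f = ((μ.real Set.univ)⁻¹ * inner ℝ (Lp.const 2 μ (1 : ℝ)) f) •
      Lp.const 2 μ (1 : ℝ) := by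
  rw [meanProj_apply, lp_const_eq_smul, inner_lp_const_one]

theorem abs_le_const_iff {f : Lp ℝ 2 μ} {M : ℝ} :
    |f| ≤ Lp.const 2 μ M ↔ ∀ᵐ x ∂μ, |f x| ≤ M := by
  rw [← Lp.coeFn_le]
  refine eventually_congr ?_
  filter_upwards [Lp.coeFn_abs f, Lp.coeFn_const 2 μ M] with x h1 h2
  rw [h1, h2]
  rfl

omit [IsFiniteMeasure μ] in
theorem inner_eq_zero_iff_of_nonneg {f g : Lp ℝ 2 μ} (hf : 0 ≤ f) (hg : 0 ≤ g) :
    inner ℝ f g = 0 ↔ ∀ᵐ x ∂μ, f x = 0 ∨ g x = 0 := by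
  rw [L2.inner_def, integral_eq_zero_iff_of_nonneg_ae _ (L2.integrable_inner f g)]
  · refine eventually_congr (Eventually.of_forall fun x => ?_)
    simp [or_comm]
  · filter_upwards [(Lp.coeFn_nonneg f).2 hf, (Lp.coeFn_nonneg g).2 hg] with x h1 h2
    simpa using mul_nonneg h2 h1

theorem eq_zero_of_nonneg_of_integral_eq_zero {f : Lp ℝ 2 μ} (hf : 0 ≤ f)
    (h : ∫ x, f x ∂μ = 0) : f = 0 := by
  rw [integral_eq_zero_iff_of_nonneg_ae ((Lp.coeFn_nonneg f).2 hf) (integrable_of_Lp f)] at h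
  exact (Lp.eq_zero_iff_ae_eq_zero).2 h

/-- The tangent at c of the convex function y ↦ y^p lies below its graph; this is Young's inequality
for y and c^{p-1}. -/
theorem mul_rpow_sub_le_rpow {p : ℝ} (hp : 1 < p) {c y : ℝ} (hc : 0 ≤ c) (hy : 0 ≤ y) :
    p * c ^ (p - 1) * y - (p - 1) * c ^ p ≤ y ^ p := by
  have hpq := Real.HolderConjugate.conjExponent hp
  have h := Real.young_inequality_of_nonneg hy (Real.rpow_nonneg hc (p - 1)) hpq
  rw [← Real.rpow_mul hc, hpq.sub_one_mul_conj] at h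
  have h1 : p.conjExponent = p / (p - 1) := rfl
  have h2 : p - 1 ≠ 0 := by linarith
  have h3 : (0 : ℝ) < p := by linarith
  have h4 : p * (y * c ^ (p - 1)) ≤ p * (y ^ p / p + c ^ p / p.conjExponent) := by gcongr
  have h5 : p * (y ^ p / p + c ^ p / p.conjExponent) = y ^ p + (p - 1) * c ^ p := by
    rw [h1]; field_simp
  linarith

namespace IsMarkovOperator

variable {T : Lp ℝ 2 μ →L[ℝ] Lp ℝ 2 μ}

theorem mono (hT : IsMarkovOperator T) {f g : Lp ℝ 2 μ} (h : f ≤ g) : T f ≤ T g := by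
  have := hT.2 (g - f) (sub_nonneg.2 h)
  rwa [map_sub, sub_nonneg] at this

theorem map_const (hT : IsMarkovOperator T) (c : ℝ) : T (Lp.const 2 μ c) = Lp.const 2 μ c := by
  rw [lp_const_eq_smul, map_smul, hT.1]

theorem abs_map_le (hT : IsMarkovOperator T) (f : Lp ℝ 2 μ) : |T f| ≤ T |f| := by
  rw [abs_le', ← map_neg]
  exact ⟨hT.mono (le_abs_self f), hT.mono (neg_le_abs f)⟩

theorem ae_abs_le (hT : IsMarkovOperator T) {f : Lp ℝ 2 μ} {M : ℝ} (hf : ∀ᵐ x ∂μ, |f x| ≤ M) :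
    ∀ᵐ x ∂μ, |T f x| ≤ M := by
  rw [← abs_le_const_iff] at hf ⊢
  rw [← hT.map_const M]
  exact (hT.abs_map_le f).trans (hT.mono hf)

theorem integral_map (hT : IsMarkovOperator T) (hs : IsSelfAdjoint T) (f : Lp ℝ 2 μ) :
    ∫ x, T f x ∂μ = ∫ x, f x ∂μ := by
  have := hs.isSymmetric (Lp.const 2 μ (1 : ℝ)) f
  simp only [ContinuousLinearMap.coe_coe] at this
  rw [hT.1] at this
  rw [← inner_lp_const_one, ← this, inner_lp_const_one]

/-- Jensen's inequality for a Markov operator and the function `|x| ^ p`. -/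
theorem ae_abs_map_rpow_le (hT : IsMarkovOperator T) {p : ℝ} (hp : 1 < p) {f g : Lp ℝ 2 μ}
    (hg : ∀ᵐ x ∂μ, g x = |f x| ^ p) : ∀ᵐ x ∂μ, |T f x| ^ p ≤ T g x := by
  -- Positivity and T1 = 1 preserve each tangent inequality almost everywhere. Rational base points
  -- keep the exceptional set null; continuity then allows the base point |Tf(x)|.
  have h1 : ∀ q : ℚ, ∀ᵐ x ∂μ, p * |(q : ℝ)| ^ (p - 1) * |T f x| - (p - 1) * |(q : ℝ)| ^ p
      ≤ T g x := by
    intro q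
    set a := p * |(q : ℝ)| ^ (p - 1) with ha
    have ha0 : 0 ≤ a := by positivity
    have h2 : a • |f| - Lp.const 2 μ ((p - 1) * |(q : ℝ)| ^ p) ≤ g := by
      rw [← Lp.coeFn_le]
      filter_upwards [hg, Lp.coeFn_sub (a • |f|) (Lp.const 2 μ ((p - 1) * |(q : ℝ)| ^ p)),
        Lp.coeFn_smul a |f|, Lp.coeFn_abs f, Lp.coeFn_const 2 μ ((p - 1) * |(q : ℝ)| ^ p)]
        with x e1 e2 e3 e4 e5
      rw [e1, e2, Pi.sub_apply, e3, Pi.smul_apply, e4, e5]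
      exact mul_rpow_sub_le_rpow hp (abs_nonneg _) (abs_nonneg _)
    have h3 := hT.mono h2
    rw [map_sub, map_smul, hT.map_const] at h3
    rw [← Lp.coeFn_le] at h3
    have h4 := hT.abs_map_le f
    rw [← Lp.coeFn_le] at h4
    filter_upwards [h3, h4, Lp.coeFn_sub (a • T |f|) (Lp.const 2 μ ((p - 1) * |(q : ℝ)| ^ p)),
        Lp.coeFn_smul a (T |f|), Lp.coeFn_abs (T f),
        Lp.coeFn_const 2 μ ((p - 1) * |(q : ℝ)| ^ p)] with x e1 e2 e3 e4 e5 e6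
    rw [e3, Pi.sub_apply, e4, Pi.smul_apply, e6, smul_eq_mul] at e1
    rw [e5] at e2
    refine le_trans ?_ e1
    have := mul_le_mul_of_nonneg_left e2 ha0
    simpa using this
  rw [← ae_all_iff] at h1
  filter_upwards [h1] with x hx
  have hc : Continuous fun r : ℝ => p * |r| ^ (p - 1) * |T f x| - (p - 1) * |r| ^ p := by
    have h5 : Continuous fun r : ℝ => |r| ^ (p - 1) :=
      continuous_abs.rpow_const fun _ => Or.inr (by linarith)
    have h6 : Continuous fun r : ℝ => |r| ^ p :=
      continuous_abs.rpow_const fun _ => Or.inr (by linarith)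
    fun_prop
  have h7 : ∀ r : ℝ, p * |r| ^ (p - 1) * |T f x| - (p - 1) * |r| ^ p ≤ T g x := fun r =>
    Rat.isDenseEmbedding_coe_real.dense.induction_on r (isClosed_le hc continuous_const) hx
  have h8 := h7 (T f x)
  have h9 : |T f x| ^ p = |T f x| ^ (p - 1) * |T f x| := by
    rw [← Real.rpow_add_one' (abs_nonneg _) (by linarith), sub_add_cancel]
  nlinarith

theorem lintegral_rpow_le (hT : IsMarkovOperator T) (hs : IsSelfAdjoint T) {p : ℝ} (hp : 1 < p)
    {f : Lp ℝ 2 μ} {M : ℝ} (hf : ∀ᵐ x ∂μ, |f x| ≤ M) :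
    ∫⁻ x, ENNReal.ofReal (|T f x| ^ p) ∂μ ≤ ∫⁻ x, ENNReal.ofReal (|f x| ^ p) ∂μ := by
  have hmeas : AEStronglyMeasurable (fun x => |f x| ^ p) μ :=
    ((Lp.stronglyMeasurable f).measurable.abs.pow_const p).aestronglyMeasurable
  have hmem : MemLp (fun x => |f x| ^ p) 2 μ := by
    refine MemLp.of_bound hmeas (M ^ p) ?_
    filter_upwards [hf] with x hx
    rw [Real.norm_of_nonneg (by positivity)]
    gcongr
  set g := hmem.toLp with hg
  have hgx : ∀ᵐ x ∂μ, g x = |f x| ^ p := hmem.coeFn_toLp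
  have hg0 : 0 ≤ g := by
    rw [← Lp.coeFn_nonneg]
    filter_upwards [hgx] with x hx
    rw [hx]
    exact Real.rpow_nonneg (abs_nonneg _) _
  calc ∫⁻ x, ENNReal.ofReal (|T f x| ^ p) ∂μ ≤ ∫⁻ x, ENNReal.ofReal (T g x) ∂μ := by
        refine lintegral_mono_ae ?_
        filter_upwards [hT.ae_abs_map_rpow_le hp hgx] with x hx
        exact ENNReal.ofReal_le_ofReal hx
    _ = ENNReal.ofReal (∫ x, T g x ∂μ) :=
        (ofReal_integral_eq_lintegral_ofReal (integrable_of_Lp _)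
          ((Lp.coeFn_nonneg _).2 (hT.2 g hg0))).symm
    _ = ENNReal.ofReal (∫ x, g x ∂μ) := by rw [hT.integral_map hs]
    _ = ∫⁻ x, ENNReal.ofReal (g x) ∂μ :=
        ofReal_integral_eq_lintegral_ofReal (integrable_of_Lp _) ((Lp.coeFn_nonneg _).2 hg0)
    _ = _ := lintegral_congr_ae (by filter_upwards [hgx] with x hx; rw [hx])

end IsMarkovOperator

omit [IsFiniteMeasure μ] in
theorem eLpNorm_eq_lintegral_ofReal {p : ℝ≥0∞} (hp : 1 < p) (hp' : p < ∞) (f : Γ → ℝ) :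
    eLpNorm f p μ = (∫⁻ x, ENNReal.ofReal (|f x| ^ p.toReal) ∂μ) ^ (1 / p.toReal) := by
  rw [eLpNorm_eq_lintegral_rpow_enorm_toReal (zero_lt_one.trans hp).ne' hp'.ne]
  congr 2
  ext x
  rw [← ENNReal.ofReal_rpow_of_nonneg (abs_nonneg _) ENNReal.toReal_nonneg, Real.enorm_eq_ofReal_abs]

theorem one_lt_toReal {p : ℝ≥0∞} (hp : 1 < p) (hp' : p < ∞) : 1 < p.toReal := by
  simpa using (ENNReal.toReal_lt_toReal ENNReal.one_ne_top hp'.ne).2 hp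

theorem IsMarkovOperator.eLpNorm_map_le {T : Lp ℝ 2 μ →L[ℝ] Lp ℝ 2 μ} (hT : IsMarkovOperator T)
    (hs : IsSelfAdjoint T) {p : ℝ≥0∞} (hp : 1 < p) (hp' : p < ∞) {f : Lp ℝ 2 μ} {M : ℝ}
    (hf : ∀ᵐ x ∂μ, |f x| ≤ M) : eLpNorm (T f) p μ ≤ eLpNorm f p μ := by
  rw [eLpNorm_eq_lintegral_ofReal hp hp', eLpNorm_eq_lintegral_ofReal hp hp']
  gcongr ?_ ^ _
  exact hT.lintegral_rpow_le hs (one_lt_toReal hp hp') hf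

omit [IsFiniteMeasure μ] in
/-- Simultaneous approximation of a function in `L_p ∩ L_q` by bounded functions. -/
theorem exists_bounded_approx {p q : ℝ≥0∞} [Fact (1 ≤ p)] [Fact (1 ≤ q)] (hp : p ≠ ∞) (hq : q ≠ ∞)
    {f : Γ → ℝ} (hf : Measurable f) (hfp : MemLp f p μ) (hfq : MemLp f q μ) :
    ∃ s : ℕ → Γ → ℝ, (∀ n, ∃ M, ∀ x, ‖s n x‖ ≤ M) ∧
      ∃ (hsp : ∀ n, MemLp (s n) p μ) (hsq : ∀ n, MemLp (s n) q μ),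
        Tendsto (fun n => (hsp n).toLp) atTop (𝓝 hfp.toLp) ∧
        Tendsto (fun n => (hsq n).toLp) atTop (𝓝 hfq.toLp) :=
  ⟨_, fun _ => SimpleFunc.exists_forall_norm_le _, _, _,
    SimpleFunc.tendsto_approxOn_range_Lp hp hf hfp, SimpleFunc.tendsto_approxOn_range_Lp hq hf hfq⟩

theorem lp_bounded_induction {p : ℝ≥0∞} [Fact (1 ≤ p)] (hp : p ≠ ∞) {C : Lp ℝ p μ → Prop}
    (hC : IsClosed {f | C f}) (h : ∀ f : Lp ℝ p μ, (∃ M, ∀ᵐ x ∂μ, |f x| ≤ M) → C f)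
    (f : Lp ℝ p μ) : C f := by
  obtain ⟨s, hs, hsp, -, hlim, -⟩ := exists_bounded_approx hp hp
    (Lp.stronglyMeasurable f).measurable (Lp.memLp f) (Lp.memLp f)
  rw [Lp.toLp_coeFn] at hlim
  refine hC.mem_of_tendsto hlim (Eventually.of_forall fun n => h _ ?_)
  obtain ⟨M, hM⟩ := hs n
  refine ⟨M, ?_⟩
  filter_upwards [(hsp n).coeFn_toLp] with x hx
  rw [hx]
  exact hM x

theorem IsMarkovOperator.norm_map_le {T : Lp ℝ 2 μ →L[ℝ] Lp ℝ 2 μ} (hT : IsMarkovOperator T)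
    (hs : IsSelfAdjoint T) (f : Lp ℝ 2 μ) : ‖T f‖ ≤ ‖f‖ := by
  refine lp_bounded_induction (C := fun f => ‖T f‖ ≤ ‖f‖) ENNReal.ofNat_ne_top
    (isClosed_le (by fun_prop) (by fun_prop)) ?_ f
  rintro f ⟨M, hM⟩
  rw [Lp.norm_def, Lp.norm_def]
  exact ENNReal.toReal_mono (Lp.eLpNorm_ne_top f)
    (hT.eLpNorm_map_le hs (by norm_num) (by simp) hM)

/-! ### Fixed functions of an irreducible Markov semigroup -/

section Semigroup

variable {S : C0Semigroup (Lp ℝ 2 μ)}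

theorem IsMarkovSemigroup.isMarkovOperator (hS : IsMarkovSemigroup S) (t : ℝ≥0) :
    IsMarkovOperator (S.op t) := by
  rcases eq_or_ne t 0 with rfl | h
  · rw [S.op_zero]
    exact ⟨rfl, fun f hf => hf⟩
  · exact hS t (pos_iff_ne_zero.2 h)

omit [IsFiniteMeasure μ] in
theorem IsSelfAdjointSemigroup.isSelfAdjoint (hS : IsSelfAdjointSemigroup S) (t : ℝ≥0) :
    IsSelfAdjoint (S.op t) := by
  rcases eq_or_ne t 0 with rfl | h
  · rw [S.op_zero]
    exact IsSelfAdjoint.one _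
  · exact hS t (pos_iff_ne_zero.2 h)

/-- Positivity gives w⁺ ≤ S_t w⁺, and both sides have the same integral. -/
theorem op_posPart_eq_of_fixed (hM : IsMarkovSemigroup S) (hs : IsSelfAdjointSemigroup S)
    {w : Lp ℝ 2 μ} (hw : ∀ t, S.op t w = w) (t : ℝ≥0) : S.op t (w ⊔ 0) = w ⊔ 0 := by
  have hT := hM.isMarkovOperator t
  have h1 : w ⊔ 0 ≤ S.op t (w ⊔ 0) := by
    refine sup_le ?_ (hT.2 _ le_sup_right)
    conv_lhs => rw [← hw t]
    exact hT.mono le_sup_left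
  rw [← sub_eq_zero]
  refine eq_zero_of_nonneg_of_integral_eq_zero (sub_nonneg.2 h1) ?_
  rw [integral_congr_ae (Lp.coeFn_sub _ _)]
  simp only [Pi.sub_apply]
  rw [integral_sub (integrable_of_Lp _) (integrable_of_Lp _),
    hT.integral_map (hs.isSelfAdjoint t), sub_self]

/-- The positivity set of a nonnegative fixed function is invariant. -/
theorem map_mem_L2On_of_fixed {T : Lp ℝ 2 μ →L[ℝ] Lp ℝ 2 μ} (hT : IsMarkovOperator T)
    (hs : IsSelfAdjoint T) {v : Lp ℝ 2 μ} (hv : 0 ≤ v) (hTv : T v = v) {E : Set Γ}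
    (hE : MeasurableSet E) (hvE : ∀ᵐ x ∂μ, x ∈ E ↔ v x ≠ 0) {f : Lp ℝ 2 μ} (hf : f ∈ L2On μ E) :
    T f ∈ L2On μ E := by
  have hsymm : ∀ a b, inner ℝ (T a) b = inner ℝ a (T b) := hs.isSymmetric
  set χ : Lp ℝ 2 μ := indicatorConstLp 2 hE.compl (measure_ne_top μ _) 1 with hχ
  have hχx : ∀ᵐ x ∂μ, χ x = Eᶜ.indicator (fun _ => (1 : ℝ)) x := indicatorConstLp_coeFn
  have hχ0 : 0 ≤ χ := by
    rw [← Lp.coeFn_nonneg]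
    filter_upwards [hχx] with x hx
    rw [hx]
    exact Set.indicator_nonneg (fun _ _ => zero_le_one) x
  -- ⟨Tχ, v⟩ = ⟨χ, v⟩ = 0 for the indicator χ of the complement, so Tχ vanishes on E; symmetry then
  -- gives ⟨χ, T|f|⟩ = 0.
  have h1 : ∀ᵐ x ∂μ, T χ x = 0 ∨ v x = 0 := by
    rw [← inner_eq_zero_iff_of_nonneg (hT.2 _ hχ0) hv, hsymm, hTv,
      inner_eq_zero_iff_of_nonneg hχ0 hv]
    filter_upwards [hχx, hvE] with x e1 e2
    by_cases hx : x ∈ E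
    · left; rw [e1]; simp [hx]
    · right; by_contra h; exact hx (e2.2 h)
  have h2 : ∀ᵐ x ∂μ, χ x = 0 ∨ T |f| x = 0 := by
    rw [← inner_eq_zero_iff_of_nonneg hχ0 (hT.2 _ (abs_nonneg f)), ← hsymm,
      inner_eq_zero_iff_of_nonneg (hT.2 _ hχ0) (abs_nonneg f)]
    filter_upwards [h1, hvE, hf, Lp.coeFn_abs f] with x e1 e2 e3 e4
    by_cases hx : x ∈ E
    · exact Or.inl (e1.resolve_right (e2.1 hx))
    · right; rw [e4, e3 hx, abs_zero]
  have h3 := hT.abs_map_le f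
  rw [← Lp.coeFn_le] at h3
  change ∀ᵐ x ∂μ, x ∉ E → T f x = 0
  filter_upwards [h2, h3, hχx, Lp.coeFn_abs (T f)] with x e1 e2 e3 e4 hx
  have h4 : χ x ≠ 0 := by rw [e3]; simp [hx]
  rw [e1.resolve_left h4, e4] at e2
  exact abs_nonpos_iff.1 e2

/-- w = u - Pu is fixed with mean zero. By irreducibility the invariant set {w > 0} is null or
conull, so w has one sign and must vanish. -/
theorem meanProj_eq_of_fixed (hM : IsMarkovSemigroup S) (hs : IsSelfAdjointSemigroup S)
    (hI : IsIrreducibleSemigroup S) {u : Lp ℝ 2 μ} (hu : ∀ t, S.op t u = u) :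
    meanProj μ 2 u = u := by
  set w := u - meanProj μ 2 u with hw
  have hwf : ∀ t, S.op t w = w := by
    intro t
    rw [hw, map_sub, hu, meanProj_apply, (hM.isMarkovOperator t).map_const]
  have hwint : ∫ x, w x ∂μ = 0 := by
    rw [integral_congr_ae (Lp.coeFn_sub _ _)]
    simp only [Pi.sub_apply]
    rw [integral_sub (integrable_of_Lp _) (integrable_of_Lp _), meanProj_apply, integral_lp_const]
    rcases eq_or_ne (μ.real Set.univ) 0 with h0 | h0
    · have : μ = 0 := by
        rwa [Measure.real, ENNReal.toReal_eq_zero_iff, or_iff_left (measure_ne_top μ _),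
          Measure.measure_univ_eq_zero] at h0
      simp [this]
    · rw [mul_inv_cancel_left₀ h0, sub_self]
  have hwm : Measurable w := (Lp.stronglyMeasurable w).measurable
  have hE : MeasurableSet {x | 0 < w x} := measurableSet_lt measurable_const hwm
  have hw0 : w = 0 := by
    rcases hI _ hE (fun t _ f hf => map_mem_L2On_of_fixed (hM.isMarkovOperator t)
      (hs.isSelfAdjoint t) (v := w ⊔ 0) le_sup_right (op_posPart_eq_of_fixed hM hs hwf t) hE
      (by
        filter_upwards [Lp.coeFn_sup w 0, Lp.coeFn_zero ℝ 2 μ] with x h1 h2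
        rw [h1, Pi.sup_apply, h2]
        simp) hf) with h | h
    · rw [← neg_eq_zero]
      refine eq_zero_of_nonneg_of_integral_eq_zero ?_ ?_
      · rw [← Lp.coeFn_nonneg]
        filter_upwards [measure_eq_zero_iff_ae_notMem.1 h, Lp.coeFn_neg w] with x h1 h2
        rw [h2]
        simpa using h1
      · rw [integral_congr_ae (Lp.coeFn_neg _)]
        simp [integral_neg, hwint]
    · refine eq_zero_of_nonneg_of_integral_eq_zero ?_ hwint
      rw [← Lp.coeFn_nonneg]
      filter_upwards [measure_eq_zero_iff_ae_notMem.1 h] with x h1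
      have : 0 < w x := by simpa using h1
      exact this.le
  exact (sub_eq_zero.1 hw0).symm

theorem isErgodic_meanProj (hM : IsMarkovSemigroup S) (hs : IsSelfAdjointSemigroup S)
    (hI : IsIrreducibleSemigroup S) : S.IsErgodic (meanProj μ 2) where
  norm_le t := (hM.isMarkovOperator t).norm_map_le (hs.isSelfAdjoint t)
  symm t := (hs.isSelfAdjoint t).isSymmetric
  proj_symm x y := by
    simp only [meanProj_two_apply, inner_smul_left, inner_smul_right, RCLike.conj_to_real]
    rw [real_inner_comm (Lp.const 2 μ (1 : ℝ)) x]
    ring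
  proj_proj x := by
    simp only [meanProj_two_apply, inner_smul_right, inner_lp_const_one, integral_lp_const]
    rw [mul_one]
    congr 1
    rcases eq_or_ne (μ.real Set.univ) 0 with h0 | h0
    · simp [h0]
    · field_simp
  op_proj t x := by rw [meanProj_apply, (hM.isMarkovOperator t).map_const]
  proj_op t x := by
    rw [meanProj_apply, meanProj_apply, (hM.isMarkovOperator t).integral_map (hs.isSelfAdjoint t)]
  proj_of_fixed _ := meanProj_eq_of_fixed hM hs hI

theorem finiteDimensional_range_meanProj : FiniteDimensional ℝ (meanProj μ 2).range := by
  refine Submodule.finiteDimensional_of_le (S₂ := Submodule.span ℝ {Lp.const 2 μ (1 : ℝ)}) ?_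
  rintro _ ⟨f, rfl⟩
  rw [Submodule.mem_span_singleton]
  exact ⟨_, (meanProj_two_apply f).symm⟩

end Semigroup

variable {Γ : Type*} [MeasurableSpace Γ] {μ : Measure Γ}

theorem lintegral_sq_eq_norm_sq (f : Lp ℝ 2 μ) :
    ∫⁻ x, ENNReal.ofReal (|f x| ^ 2) ∂μ = ENNReal.ofReal (‖f‖ ^ 2) := by
  rw [← real_inner_self_eq_norm_sq, L2.inner_def,
    ofReal_integral_eq_lintegral_ofReal (L2.integrable_inner f f)]
  · refine lintegral_congr fun x => ?_
    simp
  · exact Eventually.of_forall fun x => real_inner_self_nonneg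

/-! ### Interpolation between L₂ and L_∞ -/

section Marcinkiewicz

variable [IsFiniteMeasure μ] {D : Lp ℝ 2 μ →L[ℝ] Lp ℝ 2 μ}

/-- The level set estimate in the Marcinkiewicz interpolation argument. -/
theorem measure_lt_abs_map_le
    (hbd : ∀ (f : Lp ℝ 2 μ) (M : ℝ), 0 ≤ M → (∀ᵐ x ∂μ, |f x| ≤ M) → ∀ᵐ x ∂μ, |D f x| ≤ 2 * M)
    (f : Lp ℝ 2 μ) {t : ℝ} (ht : 0 < t) :
    μ {x | t < |D f x|} ≤ ENNReal.ofReal (4 * ‖D‖ ^ 2 / t ^ 2) *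
      μ.withDensity (fun x => ENNReal.ofReal (|f x| ^ 2)) {x | t < 4 * |f x|} := by
  have hfm : Measurable f := (Lp.stronglyMeasurable f).measurable
  have hclamp : ∀ y : ℝ, |max (-(t / 4)) (min y (t / 4))| ≤ t / 4 := fun y => by
    rw [abs_le]
    exact ⟨le_max_left _ _, max_le (by linarith) (min_le_right _ _)⟩
  -- Truncation at height t/4: the bounded part g contributes at most t/2 to |Df|, so |Df| > t
  -- forces |Dh| > t/2, and Chebyshev's inequality in L₂ applies to h.
  have hmem : MemLp (fun x => max (-(t / 4)) (min (f x) (t / 4))) 2 μ :=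
    MemLp.of_bound (by fun_prop) (t / 4) (Eventually.of_forall fun x => hclamp _)
  set g := hmem.toLp with hg
  have hgx : ∀ᵐ x ∂μ, g x = max (-(t / 4)) (min (f x) (t / 4)) := hmem.coeFn_toLp
  have hDg := hbd g (t / 4) (by positivity) (by
    filter_upwards [hgx] with x hx
    rw [hx]; exact hclamp _)
  set h := f - g with hh
  have hE : MeasurableSet {x | t < 4 * |f x|} := measurableSet_lt measurable_const (by fun_prop)
  have hhx : ∀ᵐ x ∂μ, ENNReal.ofReal (|h x| ^ 2) ≤
      {x | t < 4 * |f x|}.indicator (fun x => ENNReal.ofReal (|f x| ^ 2)) x := by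
    filter_upwards [hgx, Lp.coeFn_sub f g] with x h1 h2
    rw [h2, Pi.sub_apply, h1]
    by_cases hx : t < 4 * |f x|
    · rw [Set.indicator_of_mem (by exact hx)]
      gcongr ENNReal.ofReal (?_ ^ 2)
      rcases le_total 0 (f x) with h0 | h0
      · rw [abs_of_nonneg h0] at hx ⊢
        rw [min_eq_right (by linarith), max_eq_right (by linarith), abs_le]
        constructor <;> linarith
      · rw [abs_of_nonpos h0] at hx ⊢
        rw [min_eq_left (by linarith), max_eq_left (by linarith), abs_le]
        constructor <;> linarith
    · have h3 := abs_le.1 (show |f x| ≤ t / 4 by linarith)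
      rw [min_eq_left h3.2, max_eq_right h3.1]
      simp
  have hsub : ∀ᵐ x ∂μ, t < |D f x| →
      ENNReal.ofReal ((t / 2) ^ 2) ≤ ENNReal.ofReal (|D h x| ^ 2) := by
    have hD : D h = D f - D g := by rw [hh, map_sub]
    filter_upwards [hDg, Lp.coeFn_sub (D f) (D g)] with x h1 h2 hx
    rw [hD, h2, Pi.sub_apply]
    gcongr
    have := abs_sub_abs_le_abs_sub (D f x) (D g x)
    linarith
  have hc : ENNReal.ofReal ((t / 2) ^ 2) ≠ 0 := by
    rw [Ne, ENNReal.ofReal_eq_zero, not_le]; positivity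
  calc μ {x | t < |D f x|}
      ≤ μ {x | ENNReal.ofReal ((t / 2) ^ 2) ≤ ENNReal.ofReal (|D h x| ^ 2)} :=
        measure_mono_ae hsub
    _ ≤ (∫⁻ x, ENNReal.ofReal (|D h x| ^ 2) ∂μ) / ENNReal.ofReal ((t / 2) ^ 2) :=
        meas_ge_le_lintegral_div
          (((Lp.stronglyMeasurable (D h)).measurable.abs.pow_const 2).ennreal_ofReal.aemeasurable)
          hc ENNReal.ofReal_ne_top
    _ ≤ (ENNReal.ofReal (‖D‖ ^ 2) * ∫⁻ x, ENNReal.ofReal (|h x| ^ 2) ∂μ) /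
          ENNReal.ofReal ((t / 2) ^ 2) := by
        gcongr
        rw [lintegral_sq_eq_norm_sq, lintegral_sq_eq_norm_sq, ← ENNReal.ofReal_mul (by positivity),
          ← mul_pow]
        gcongr
        exact D.le_opNorm h
    _ ≤ (ENNReal.ofReal (‖D‖ ^ 2) * μ.withDensity (fun x => ENNReal.ofReal (|f x| ^ 2))
          {x | t < 4 * |f x|}) / ENNReal.ofReal ((t / 2) ^ 2) := by
        gcongr
        rw [withDensity_apply _ hE, ← lintegral_indicator hE]
        exact lintegral_mono_ae hhx
    _ = _ := by
        rw [ENNReal.mul_div_right_comm, ← ENNReal.ofReal_div_of_pos (by positivity)]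
        congr 2
        field_simp
        ring

/-- A special case of the Marcinkiewicz interpolation theorem, between `L₂` and `L_∞`. -/
theorem exists_lintegral_rpow_map_le {p : ℝ} (hp : 2 < p) : ∃ C : ℝ≥0∞, C ≠ ∞ ∧
    ∀ D : Lp ℝ 2 μ →L[ℝ] Lp ℝ 2 μ,
    (∀ (f : Lp ℝ 2 μ) (M : ℝ), 0 ≤ M → (∀ᵐ x ∂μ, |f x| ≤ M) → ∀ᵐ x ∂μ, |D f x| ≤ 2 * M) →
    ∀ f : Lp ℝ 2 μ, ∫⁻ x, ENNReal.ofReal (|D f x| ^ p) ∂μ ≤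
      C * ENNReal.ofReal (‖D‖ ^ 2) * ∫⁻ x, ENNReal.ofReal (|f x| ^ p) ∂μ := by
  have hp2 : ENNReal.ofReal (p - 2) ≠ 0 := by
    rw [Ne, ENNReal.ofReal_eq_zero, not_le]; linarith
  refine ⟨ENNReal.ofReal p * 4 * (ENNReal.ofReal (p - 2))⁻¹ * ENNReal.ofReal (4 ^ (p - 2)),
    by finiteness, fun D hbd f => ?_⟩
  -- The layer cake formula is used twice: for |Df|^p under μ, and for (4|f|)^{p-2} under |f|² dμ,
  -- whose level sets appear in the estimate above. This second use needs p > 2.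
  set ν := μ.withDensity (fun x => ENNReal.ofReal (|f x| ^ 2)) with hν
  have hfm : Measurable f := (Lp.stronglyMeasurable f).measurable
  have hDm : Measurable (D f) := (Lp.stronglyMeasurable (D f)).measurable
  set I := ∫⁻ t in Set.Ioi (0 : ℝ), ν {x | t < 4 * |f x|} * ENNReal.ofReal (t ^ (p - 2 - 1)) with hI
  have h1 : ∫⁻ x, ENNReal.ofReal ((4 * |f x|) ^ (p - 2)) ∂ν = ENNReal.ofReal (p - 2) * I :=
    lintegral_rpow_eq_lintegral_meas_lt_mul ν (Eventually.of_forall fun x => by positivity)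
      (by fun_prop) (by linarith)
  have h2 : ∫⁻ x, ENNReal.ofReal ((4 * |f x|) ^ (p - 2)) ∂ν =
      ENNReal.ofReal (4 ^ (p - 2)) * ∫⁻ x, ENNReal.ofReal (|f x| ^ p) ∂μ := by
    rw [hν, lintegral_withDensity_eq_lintegral_mul _ (by fun_prop) (by fun_prop),
      ← lintegral_const_mul' _ _ ENNReal.ofReal_ne_top]
    refine lintegral_congr fun x => ?_
    rw [Pi.mul_apply, ← ENNReal.ofReal_mul (by positivity), ← ENNReal.ofReal_mul (by positivity),
      Real.mul_rpow (by norm_num) (abs_nonneg _)]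
    congr 1
    have : |f x| ^ p = |f x| ^ (p - 2) * |f x| ^ (2 : ℕ) := by
      rw [← Real.rpow_natCast, ← Real.rpow_add_of_nonneg (abs_nonneg _) (by linarith) (by simp)]
      congr 1; push_cast; ring
    rw [this]; ring
  have h3 : I = (ENNReal.ofReal (p - 2))⁻¹ *
      (ENNReal.ofReal (4 ^ (p - 2)) * ∫⁻ x, ENNReal.ofReal (|f x| ^ p) ∂μ) := by
    rw [← h2, h1, ← mul_assoc, ENNReal.inv_mul_cancel hp2 ENNReal.ofReal_ne_top, one_mul]
  rw [lintegral_rpow_eq_lintegral_meas_lt_mul μ (Eventually.of_forall fun x => abs_nonneg _)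
    (by fun_prop) (by linarith)]
  have h4 : ∫⁻ t in Set.Ioi (0 : ℝ), μ {x | t < |D f x|} * ENNReal.ofReal (t ^ (p - 1)) ≤
      ENNReal.ofReal (4 * ‖D‖ ^ 2) * I := by
    rw [hI, ← lintegral_const_mul' _ _ ENNReal.ofReal_ne_top]
    refine setLIntegral_mono' measurableSet_Ioi fun t ht => ?_
    have ht : 0 < t := ht
    refine (mul_le_mul_left (measure_lt_abs_map_le hbd f ht) _).trans (le_of_eq ?_)
    rw [mul_right_comm, ← ENNReal.ofReal_mul (by positivity), ← mul_assoc,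
      mul_right_comm (ENNReal.ofReal _), ← ENNReal.ofReal_mul (by positivity)]
    congr 2
    have : t ^ (p - 1) = t ^ (p - 2 - 1) * t ^ (2 : ℕ) := by
      rw [← Real.rpow_natCast, ← Real.rpow_add ht]
      congr 1; push_cast; ring
    rw [this]
    field_simp
  refine (mul_le_mul_right h4 _).trans (le_of_eq ?_)
  rw [h3, ENNReal.ofReal_mul (by norm_num), ENNReal.ofReal_ofNat]
  ring

end Marcinkiewicz

/-! ### Duality for symmetric operators -/

/-- `η` bounds the norm of `D` in `L_p` on the bounded functions. -/
def LpBoundedBy (D : Lp ℝ 2 μ →L[ℝ] Lp ℝ 2 μ) (p : ℝ) (η : ℝ≥0∞) : Prop :=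
  ∀ f : Lp ℝ 2 μ, (∃ M, ∀ᵐ x ∂μ, |f x| ≤ M) →
    (∫⁻ x, ENNReal.ofReal (|D f x| ^ p) ∂μ) ^ (1 / p) ≤
      η * (∫⁻ x, ENNReal.ofReal (|f x| ^ p) ∂μ) ^ (1 / p)

theorem ofReal_abs_rpow (a : ℝ) {p : ℝ} (hp : 0 ≤ p) :
    ENNReal.ofReal (|a| ^ p) = ENNReal.ofReal |a| ^ p :=
  (ENNReal.ofReal_rpow_of_nonneg (abs_nonneg _) hp).symm

theorem LpBoundedBy.dual [IsFiniteMeasure μ] {D : Lp ℝ 2 μ →L[ℝ] Lp ℝ 2 μ} {p q : ℝ}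
    (hpq : p.HolderConjugate q) {η : ℝ≥0∞} (hq : LpBoundedBy D q η)
    (hsymm : ∀ f g, inner ℝ (D f) g = inner ℝ f (D g))
    (hbd : ∀ f : Lp ℝ 2 μ, (∃ M, ∀ᵐ x ∂μ, |f x| ≤ M) → ∃ M, ∀ᵐ x ∂μ, |D f x| ≤ M) :
    LpBoundedBy D p η := by
  intro f hf
  obtain ⟨M, hM⟩ := hbd f hf
  have hp0 : 0 < p := hpq.pos
  have hp1 : 1 < p := hpq.lt
  set w := D f with hw
  have hwm : Measurable w := (Lp.stronglyMeasurable w).measurable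
  let sgn : ℝ → ℝ := fun a => if 0 ≤ a then 1 else -1
  have hsgnm : Measurable sgn := measurable_const.ite measurableSet_Ici measurable_const
  have hsgn : ∀ a : ℝ, |sgn a| = 1 ∧ sgn a * a = |a| := by
    intro a
    by_cases h : 0 ≤ a
    · simp [sgn, h, abs_of_nonneg h]
    · simp [sgn, h, abs_of_neg (not_le.1 h)]
  have habs : ∀ a : ℝ, |sgn a * |a| ^ (p - 1)| = |a| ^ (p - 1) := by
    intro a
    rw [abs_mul, (hsgn a).1, one_mul, abs_of_nonneg (by positivity)]
  have hgb : ∀ᵐ x ∂μ, |sgn (w x) * |w x| ^ (p - 1)| ≤ M ^ (p - 1) := by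
    filter_upwards [hM] with x hx
    rw [habs]
    exact Real.rpow_le_rpow (abs_nonneg _) hx (by linarith)
  have hgm : Measurable fun x => sgn (w x) * |w x| ^ (p - 1) := by
    fun_prop
  -- The extremal function for Hölder's inequality: wg = |w|^p and |g|^q = |w|^p. It is bounded
  -- because w is, so the L_q hypothesis applies to it.
  have hmem : MemLp (fun x => sgn (w x) * |w x| ^ (p - 1)) 2 μ :=
    MemLp.of_bound hgm.aestronglyMeasurable (M ^ (p - 1)) hgb
  set g := hmem.toLp with hg
  have hgx : ∀ᵐ x ∂μ, g x = sgn (w x) * |w x| ^ (p - 1) := hmem.coeFn_toLp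
  set J := ∫⁻ x, ENNReal.ofReal (|w x| ^ p) ∂μ with hJ
  have hJtop : J ≠ ∞ := by
    refine (lt_of_le_of_lt (lintegral_mono_ae (g := fun _ => ENNReal.ofReal (M ^ p)) ?_) ?_).ne
    · filter_upwards [hM] with x hx
      gcongr
    · simp [ENNReal.mul_lt_top_iff]
  have hgJ : ∫⁻ x, ENNReal.ofReal (|g x| ^ q) ∂μ = J := by
    refine lintegral_congr_ae ?_
    filter_upwards [hgx] with x hx
    rw [hx, habs, ← Real.rpow_mul (abs_nonneg _), hpq.sub_one_mul_conj]
  have hJle : J ≤ (∫⁻ x, ENNReal.ofReal (|f x| ^ p) ∂μ) ^ (1 / p) *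
      (∫⁻ x, ENNReal.ofReal (|D g x| ^ q) ∂μ) ^ (1 / q) := by
    have hprod : ∀ᵐ x ∂μ, inner ℝ (w x) (g x) = |w x| ^ p := by
      filter_upwards [hgx] with x hx
      rw [hx]
      have e2 : |w x| ^ p = |w x| ^ (p - 1) * |w x| := by
        rw [← Real.rpow_add_one' (abs_nonneg _) (by linarith), sub_add_cancel]
      rw [e2, ← (hsgn (w x)).2]
      simp only [RCLike.inner_apply, conj_trivial]
      ring_nf
    have e1 : J = ENNReal.ofReal (inner ℝ w g) := by
      rw [L2.inner_def, ofReal_integral_eq_lintegral_ofReal (L2.integrable_inner w g)]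
      · refine lintegral_congr_ae ?_
        filter_upwards [hprod] with x hx
        rw [hx]
      · filter_upwards [hprod] with x hx
        rw [hx]
        exact Real.rpow_nonneg (abs_nonneg _) _
    rw [e1, hw, hsymm, L2.inner_def]
    refine (ENNReal.ofReal_le_ofReal (le_abs_self _)).trans ?_
    rw [← Real.enorm_eq_ofReal_abs]
    refine (enorm_integral_le_lintegral_enorm _).trans ?_
    have hfm : AEMeasurable (fun x => ENNReal.ofReal |f x|) μ :=
      (Lp.stronglyMeasurable f).measurable.abs.ennreal_ofReal.aemeasurable
    have hDgm : AEMeasurable (fun x => ENNReal.ofReal |D g x|) μ :=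
      (Lp.stronglyMeasurable (D g)).measurable.abs.ennreal_ofReal.aemeasurable
    have := ENNReal.lintegral_mul_le_Lp_mul_Lq μ hpq hfm hDgm
    simp only [← ofReal_abs_rpow _ hp0.le, ← ofReal_abs_rpow _ hpq.symm.pos.le, Pi.mul_apply,
      ← ENNReal.ofReal_mul (abs_nonneg _), ← abs_mul] at this
    refine le_trans (le_of_eq (lintegral_congr fun x => ?_)) this
    rw [Real.enorm_eq_ofReal_abs]
    simp [mul_comm]
  -- J = ⟨f, Dg⟩ ≤ η ‖f‖_p J^{1/q}; as J is finite, division by J^{1/q} is legitimate unless J = 0.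
  have h5 := hJle.trans (mul_le_mul_right (hq g ⟨_, by
    filter_upwards [hgx, hgb] with x h1 h2
    rw [h1]; exact h2⟩) _)
  rw [hgJ, ← mul_assoc, mul_comm _ η] at h5
  rcases eq_or_ne J 0 with h0 | h0
  · rw [h0, ENNReal.zero_rpow_of_pos (by positivity)]
    exact zero_le
  · have h6 : J ^ (1 / p) = J / J ^ (1 / q) := by
      rw [ENNReal.eq_div_iff (by simp [h0, hJtop]) (by simp [h0, hJtop]),
        ← ENNReal.rpow_add _ _ h0 hJtop, add_comm]
      have := hpq.inv_add_inv_eq_one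
      rw [one_div, one_div, this, ENNReal.rpow_one]
    rw [h6]
    exact ENNReal.div_le_of_le_mul h5


/-! ### Extension of Markov operators from bounded functions to L_p -/

variable {Γ : Type*} [MeasurableSpace Γ] {μ : Measure Γ} [IsFiniteMeasure μ]

variable (μ) in
/-- The essentially bounded functions in `L₂`. -/
def boundedL2 : Submodule ℝ (Lp ℝ 2 μ) where
  carrier := {f | ∃ M, ∀ᵐ x ∂μ, |f x| ≤ M}
  add_mem' := by
    rintro f g ⟨M, hM⟩ ⟨N, hN⟩
    refine ⟨M + N, ?_⟩
    filter_upwards [hM, hN, Lp.coeFn_add f g] with x h1 h2 h3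
    rw [h3]
    exact (abs_add_le _ _).trans (add_le_add h1 h2)
  zero_mem' := by
    refine ⟨0, ?_⟩
    filter_upwards [Lp.coeFn_zero ℝ 2 μ] with x hx
    rw [hx]
    simp
  smul_mem' := by
    rintro c f ⟨M, hM⟩
    refine ⟨|c| * M, ?_⟩
    filter_upwards [hM, Lp.coeFn_smul c f] with x h1 h2
    rw [h2, Pi.smul_apply, smul_eq_mul, abs_mul]
    gcongr

theorem boundedL2.memLp {f : Lp ℝ 2 μ} (hf : f ∈ boundedL2 μ) (p : ℝ≥0∞) : MemLp f p μ := by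
  obtain ⟨M, hM⟩ := hf
  exact MemLp.of_bound (Lp.aestronglyMeasurable f) M hM

variable (μ) in
/-- The inclusion of the bounded functions into `L_p`. -/
def boundedToLp (p : ℝ≥0∞) : boundedL2 μ →ₗ[ℝ] Lp ℝ p μ where
  toFun f := (boundedL2.memLp f.2 p).toLp
  map_add' f g := by
    rw [← MemLp.toLp_add]
    exact MemLp.toLp_congr _ _ (Lp.coeFn_add _ _)
  map_smul' c f := by
    rw [RingHom.id_apply, ← MemLp.toLp_const_smul]
    exact MemLp.toLp_congr _ _ (Lp.coeFn_smul _ _)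

theorem coeFn_boundedToLp {p : ℝ≥0∞} (f : boundedL2 μ) : boundedToLp μ p f =ᵐ[μ] (f : Lp ℝ 2 μ) :=
  MemLp.coeFn_toLp (boundedL2.memLp f.2 p)

theorem norm_boundedToLp {p : ℝ≥0∞} (f : boundedL2 μ) :
    ‖boundedToLp μ p f‖ = (eLpNorm (f : Lp ℝ 2 μ) p μ).toReal :=
  Lp.norm_toLp _ (boundedL2.memLp f.2 p)

theorem exists_boundedToLp_eq {p : ℝ≥0∞} {g : Lp ℝ p μ} (hg : ∃ M, ∀ᵐ x ∂μ, |g x| ≤ M) :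
    ∃ f, boundedToLp μ p f = g := by
  obtain ⟨M, hM⟩ := hg
  have hmem : MemLp g 2 μ := MemLp.of_bound (Lp.aestronglyMeasurable g) M hM
  have h : ∀ᵐ x ∂μ, |(hmem.toLp g : Lp ℝ 2 μ) x| ≤ M := by
    filter_upwards [hM, hmem.coeFn_toLp] with x h1 h2
    rwa [h2]
  refine ⟨⟨hmem.toLp g, M, h⟩, Lp.ext ((coeFn_boundedToLp _).trans hmem.coeFn_toLp)⟩

theorem denseRange_boundedToLp {p : ℝ≥0∞} [Fact (1 ≤ p)] (hp : p ≠ ∞) :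
    DenseRange (boundedToLp μ p) := by
  intro g
  refine lp_bounded_induction (C := fun g => g ∈ closure (Set.range (boundedToLp μ p))) hp
    isClosed_closure (fun g hg => subset_closure ?_) g
  exact exists_boundedToLp_eq hg

theorem IsMarkovOperator.map_mem_boundedL2 {T : Lp ℝ 2 μ →L[ℝ] Lp ℝ 2 μ} (hT : IsMarkovOperator T)
    {f : Lp ℝ 2 μ} (hf : f ∈ boundedL2 μ) : T f ∈ boundedL2 μ := by
  obtain ⟨M, hM⟩ := hf
  exact ⟨M, hT.ae_abs_le hM⟩

/-- To be an `L_p`-version can be checked on the bounded functions. -/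
theorem isLpVersion_of_bounded {p : ℝ≥0∞} [Fact (1 ≤ p)] (hp : p ≠ ∞)
    {T : Lp ℝ 2 μ →L[ℝ] Lp ℝ 2 μ} {U : Lp ℝ p μ →L[ℝ] Lp ℝ p μ}
    (h : ∀ f : boundedL2 μ, T f =ᵐ[μ] U (boundedToLp μ p f)) : IsLpVersion T U := by
  intro f g hfg
  have hgm : Measurable g := (Lp.stronglyMeasurable g).measurable
  have hf2 : MemLp g 2 μ := (memLp_congr_ae hfg).1 (Lp.memLp f)
  -- One sequence of bounded functions converges in both L₂ and L_p. The images converge in measure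
  -- to Tf and to Ug, so these agree almost everywhere.
  obtain ⟨s, hs, hs2, hsp, hl2, hlp⟩ :=
    exists_bounded_approx ENNReal.ofNat_ne_top hp hgm hf2 (Lp.memLp g)
  have e2 : hf2.toLp = f := Lp.ext (hf2.coeFn_toLp.trans hfg.symm)
  rw [e2] at hl2
  rw [Lp.toLp_coeFn] at hlp
  have h1 := tendstoInMeasure_of_tendsto_Lp ((T.continuous.tendsto f).comp hl2)
  have h2 := tendstoInMeasure_of_tendsto_Lp ((U.continuous.tendsto g).comp hlp)
  have h3 : ∀ n, T (hs2 n).toLp =ᵐ[μ] U (hsp n).toLp := by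
    intro n
    obtain ⟨M, hM⟩ := hs n
    have hb : (hs2 n).toLp ∈ boundedL2 μ := by
      refine ⟨M, ?_⟩
      filter_upwards [(hs2 n).coeFn_toLp] with x hx
      rw [hx]; exact hM x
    have := h ⟨_, hb⟩
    rwa [show boundedToLp μ p ⟨_, hb⟩ = (hsp n).toLp from Lp.ext
      ((coeFn_boundedToLp _).trans ((hs2 n).coeFn_toLp.trans (hsp n).coeFn_toLp.symm))] at this
  exact tendstoInMeasure_ae_unique (h1.congr_left h3) h2

/-- T is an L_p contraction on the bounded functions, which are dense in L_p for finite p. -/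
theorem existsUnique_isLpVersion {T : Lp ℝ 2 μ →L[ℝ] Lp ℝ 2 μ} (hT : IsMarkovOperator T)
    (hs : IsSelfAdjoint T) {p : ℝ≥0∞} [Fact (1 ≤ p)] (hp : 1 < p) (hp' : p < ∞) :
    ∃! U : Lp ℝ p μ →L[ℝ] Lp ℝ p μ, IsLpVersion T U := by
  have hd := denseRange_boundedToLp (μ := μ) hp'.ne
  let T' : boundedL2 μ →ₗ[ℝ] boundedL2 μ :=
    (T : Lp ℝ 2 μ →ₗ[ℝ] Lp ℝ 2 μ).restrict fun f hf => hT.map_mem_boundedL2 hf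
  have hbound : ∀ f, ‖(boundedToLp μ p ∘ₗ T') f‖ ≤ 1 * ‖boundedToLp μ p f‖ := by
    intro f
    rw [one_mul, LinearMap.comp_apply, norm_boundedToLp, norm_boundedToLp]
    obtain ⟨M, hM⟩ := f.2
    exact ENNReal.toReal_mono (boundedL2.memLp f.2 p).eLpNorm_ne_top
      (hT.eLpNorm_map_le hs hp hp' hM)
  refine ⟨(boundedToLp μ p ∘ₗ T').extendOfNorm (boundedToLp μ p), ?_, fun U hU => ?_⟩
  · refine isLpVersion_of_bounded hp'.ne fun f => ?_
    rw [LinearMap.extendOfNorm_eq hd ⟨1, hbound⟩]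
    exact (coeFn_boundedToLp (T' f)).symm
  · refine (LinearMap.extendOfNorm_unique hd 1 hbound U ?_).symm
    ext1 f
    exact Lp.ext ((hU f _ (coeFn_boundedToLp f).symm).symm.trans (coeFn_boundedToLp (T' f)).symm)

theorem meanProj_congr {p q : ℝ≥0∞} [Fact (1 ≤ p)] [Fact (1 ≤ q)] {f : Lp ℝ p μ} {g : Lp ℝ q μ}
    (h : f =ᵐ[μ] g) : meanProj μ p f =ᵐ[μ] meanProj μ q g := by
  rw [meanProj_apply, meanProj_apply, integral_congr_ae h]
  exact (Lp.coeFn_const _ _ _).trans (Lp.coeFn_const _ _ _).symm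

theorem ae_abs_meanProj_le {f : Lp ℝ 2 μ} {M : ℝ} (hM : 0 ≤ M) (hf : ∀ᵐ x ∂μ, |f x| ≤ M) :
    ∀ᵐ x ∂μ, |meanProj μ 2 f x| ≤ M := by
  rw [meanProj_apply]
  filter_upwards [Lp.coeFn_const 2 μ ((μ.real Set.univ)⁻¹ * ∫ x, f x ∂μ)] with x hx
  rw [hx, Function.const_apply, abs_mul, abs_of_nonneg (by positivity)]
  have h1 : |∫ x, f x ∂μ| ≤ M * μ.real Set.univ := by
    simpa using norm_integral_le_of_norm_le_const (f := f) (C := M) (by simpa using hf)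
  refine (mul_le_mul_of_nonneg_left h1 (by positivity)).trans ?_
  rcases eq_or_ne (μ.real Set.univ) 0 with h0 | h0
  · simpa [h0] using hM
  · rw [mul_left_comm, inv_mul_cancel₀ h0, mul_one]

theorem IsMarkovOperator.ae_abs_sub_meanProj_le {T : Lp ℝ 2 μ →L[ℝ] Lp ℝ 2 μ}
    (hT : IsMarkovOperator T) (f : Lp ℝ 2 μ) (M : ℝ) (hM : 0 ≤ M) (hf : ∀ᵐ x ∂μ, |f x| ≤ M) :
    ∀ᵐ x ∂μ, |(T - meanProj μ 2) f x| ≤ 2 * M := by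
  filter_upwards [hT.ae_abs_le hf, ae_abs_meanProj_le hM hf,
    Lp.coeFn_sub (T f) (meanProj μ 2 f)] with x h1 h2 h3
  rw [sub_apply, h3, Pi.sub_apply]
  exact (abs_sub _ _).trans (by linarith)

/-! ### Operator norm convergence in L_p -/

section Convergence

/-- Convergence to `0` of the norms in `L_p`, tested on bounded functions. -/
def TendstoZeroLp (D : ℝ≥0 → (Lp ℝ 2 μ →L[ℝ] Lp ℝ 2 μ)) (p : ℝ) : Prop :=
  ∃ c : ℝ≥0 → ℝ≥0∞, Tendsto c atTop (𝓝 0) ∧ ∀ t, LpBoundedBy (D t) p (c t)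

theorem tendstoZeroLp_of_two_lt {D : ℝ≥0 → (Lp ℝ 2 μ →L[ℝ] Lp ℝ 2 μ)}
    (hbd : ∀ t (f : Lp ℝ 2 μ) (M : ℝ), 0 ≤ M → (∀ᵐ x ∂μ, |f x| ≤ M) → ∀ᵐ x ∂μ, |D t f x| ≤ 2 * M)
    (hlim : Tendsto (fun t => ‖D t‖) atTop (𝓝 0)) {p : ℝ} (hp : 2 < p) : TendstoZeroLp D p := by
  obtain ⟨C, hC, hmain⟩ := exists_lintegral_rpow_map_le (μ := μ) hp
  refine ⟨fun t => (C * ENNReal.ofReal (‖D t‖ ^ 2)) ^ (1 / p), ?_, fun t f _ => ?_⟩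
  · have h1 : Tendsto (fun t => ENNReal.ofReal (‖D t‖ ^ 2)) atTop (𝓝 0) := by
      simpa using ENNReal.tendsto_ofReal (hlim.pow 2)
    have h2 := ENNReal.Tendsto.const_mul h1 (Or.inr hC)
    rw [mul_zero] at h2
    have h3 := (ENNReal.continuous_rpow_const (y := 1 / p)).tendsto 0 |>.comp h2
    rwa [ENNReal.zero_rpow_of_pos (by positivity)] at h3
  · rw [← ENNReal.mul_rpow_of_nonneg _ _ (by positivity)]
    exact ENNReal.rpow_le_rpow (hmain (D t) (hbd t) f) (by positivity)

omit [IsFiniteMeasure μ] in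
theorem tendstoZeroLp_two {D : ℝ≥0 → (Lp ℝ 2 μ →L[ℝ] Lp ℝ 2 μ)}
    (hlim : Tendsto (fun t => ‖D t‖) atTop (𝓝 0)) : TendstoZeroLp D 2 := by
  refine ⟨fun t => ENNReal.ofReal ‖D t‖, by simpa using ENNReal.tendsto_ofReal hlim, fun t f _ => ?_⟩
  have h : ∀ g : Lp ℝ 2 μ, (∫⁻ x, ENNReal.ofReal (|g x| ^ (2 : ℝ)) ∂μ) ^ (1 / (2 : ℝ)) =
      ENNReal.ofReal ‖g‖ := by
    intro g
    have := lintegral_sq_eq_norm_sq g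
    simp only [← Real.rpow_natCast, Nat.cast_ofNat] at this
    rw [this, ← ENNReal.ofReal_rpow_of_nonneg (norm_nonneg _) (by norm_num), ← ENNReal.rpow_mul]
    norm_num
  rw [h, h, ← ENNReal.ofReal_mul (norm_nonneg _)]
  exact ENNReal.ofReal_le_ofReal ((D t).le_opNorm f)

/-- For p > 2 interpolation applies; for p < 2 the conjugate exponent exceeds 2 and duality applies.
-/
theorem tendstoZeroLp {D : ℝ≥0 → (Lp ℝ 2 μ →L[ℝ] Lp ℝ 2 μ)}
    (hbd : ∀ t (f : Lp ℝ 2 μ) (M : ℝ), 0 ≤ M → (∀ᵐ x ∂μ, |f x| ≤ M) → ∀ᵐ x ∂μ, |D t f x| ≤ 2 * M)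
    (hsymm : ∀ t f g, inner ℝ (D t f) g = inner ℝ f (D t g))
    (hlim : Tendsto (fun t => ‖D t‖) atTop (𝓝 0)) {p : ℝ} (hp : 1 < p) : TendstoZeroLp D p := by
  rcases lt_trichotomy p 2 with h | rfl | h
  · have hpq := Real.HolderConjugate.conjExponent hp
    have hq : 2 < p.conjExponent := by
      rw [Real.conjExponent, lt_div_iff₀ (by linarith)]; linarith
    obtain ⟨c, hc, hb⟩ := tendstoZeroLp_of_two_lt hbd hlim hq
    refine ⟨c, hc, fun t => (hb t).dual hpq (hsymm t) ?_⟩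
    rintro f ⟨M, hM⟩
    exact ⟨_, hbd t f |M| (abs_nonneg M) (hM.mono fun x hx => hx.trans (le_abs_self M))⟩
  · exact tendstoZeroLp_two hlim
  · exact tendstoZeroLp_of_two_lt hbd hlim h

theorem tendsto_lpVersion {T : ℝ≥0 → (Lp ℝ 2 μ →L[ℝ] Lp ℝ 2 μ)}
    {p : ℝ≥0∞} [Fact (1 ≤ p)] (hp : 1 < p) (hp' : p < ∞)
    (h : TendstoZeroLp (fun t => T t - meanProj μ 2) p.toReal)
    {Sp : ℝ≥0 → (Lp ℝ p μ →L[ℝ] Lp ℝ p μ)} (hSp : ∀ t, IsLpVersion (T t) (Sp t)) :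
    Tendsto Sp atTop (𝓝 (meanProj μ p)) := by
  obtain ⟨c, hc, hb⟩ := h
  rw [tendsto_iff_norm_sub_tendsto_zero]
  have hc' : Tendsto (fun t => (c t).toReal) atTop (𝓝 0) := by
    simpa [Function.comp_def] using (ENNReal.tendsto_toReal ENNReal.zero_ne_top).comp hc
  refine squeeze_zero' (Eventually.of_forall fun _ => norm_nonneg _) ?_ hc'
  -- Finiteness of c t is needed because `toReal` sends ∞ to 0.
  filter_upwards [hc.eventually_lt_const ENNReal.zero_lt_top] with t ht
  refine ContinuousLinearMap.opNorm_le_bound _ ENNReal.toReal_nonneg fun g => ?_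
  refine lp_bounded_induction
    (C := fun g => ‖(Sp t - meanProj μ p) g‖ ≤ (c t).toReal * ‖g‖) hp'.ne
    (isClosed_le (by fun_prop) (by fun_prop)) (fun g hg => ?_) g
  obtain ⟨f, rfl⟩ := exists_boundedToLp_eq hg
  have hae : (Sp t - meanProj μ p) (boundedToLp μ p f) =ᵐ[μ] (T t - meanProj μ 2) f := by
    have hf := coeFn_boundedToLp (p := p) f
    filter_upwards [hSp t f _ hf.symm, meanProj_congr hf,
      Lp.coeFn_sub (Sp t (boundedToLp μ p f)) (meanProj μ p (boundedToLp μ p f)),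
      Lp.coeFn_sub (T t f) (meanProj μ 2 f)] with x h1 h2 h3 h4
    rw [sub_apply, sub_apply, h3, h4, Pi.sub_apply, Pi.sub_apply, h1, h2]
  rw [norm_boundedToLp, Lp.norm_def, ← ENNReal.toReal_mul, eLpNorm_congr_ae hae]
  refine ENNReal.toReal_mono
    (ENNReal.mul_ne_top ht.ne (boundedL2.memLp f.2 p).eLpNorm_ne_top) ?_
  rw [eLpNorm_eq_lintegral_ofReal hp hp', eLpNorm_eq_lintegral_ofReal hp hp']
  exact hb t f f.2

end Convergence

end

theorem theorem2p4 {Γ : Type*} [MeasurableSpace Γ] (μ : Measure Γ) [IsFiniteMeasure μ]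
    (S : C0Semigroup (Lp ℝ 2 μ)) (hSelfAdjoint : IsSelfAdjointSemigroup S)
    (hMarkov : IsMarkovSemigroup S) (hIrreducible : IsIrreducibleSemigroup S)
    (A : Lp ℝ 2 μ →ₗ.[ℝ] Lp ℝ 2 μ) (hA : -A = S.generator) :
    -- the three conditions are equivalent
    [ (0 : ℝ) ∉ A.essSpectrum,
      Tendsto (fun t : ℝ≥0 => S.op t) atTop (𝓝 (meanProj μ 2)),
      ∃ ε : ℝ, 0 < ε ∧ ∀ t : ℝ≥0, 0 < t →
        ‖S.op t - meanProj μ 2‖ ≤ Real.exp (-(ε * (t : ℝ))) ].TFAE ∧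
    -- for `1 < p < ∞` the operators `S_t^(p)` exist and are unique, and they converge in
    -- operator norm to `P` on `L_p` if the three conditions hold
    ∀ (p : ℝ≥0∞) [Fact (1 ≤ p)], 1 < p → p < ∞ →
      (∀ t : ℝ≥0, ∃! U : Lp ℝ p μ →L[ℝ] Lp ℝ p μ, IsLpVersion (S.op t) U) ∧
      ((0 : ℝ) ∉ A.essSpectrum →
        ∀ Sp : ℝ≥0 → (Lp ℝ p μ →L[ℝ] Lp ℝ p μ), (∀ t : ℝ≥0, IsLpVersion (S.op t) (Sp t)) →
          Tendsto Sp atTop (𝓝 (meanProj μ p))) := by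
  have hE := isErgodic_meanProj hMarkov hSelfAdjoint hIrreducible
  have htfae := hE.tfae finiteDimensional_range_meanProj hA
  refine ⟨htfae, fun p _ hp hp' => ⟨fun t => existsUnique_isLpVersion
    (hMarkov.isMarkovOperator t) (hSelfAdjoint.isSelfAdjoint t) hp hp', fun h0 Sp hSp => ?_⟩⟩
  have hlim := (htfae.out 0 1).1 h0
  refine tendsto_lpVersion hp hp' (tendstoZeroLp
    (fun t => (hMarkov.isMarkovOperator t).ae_abs_sub_meanProj_le) (fun t f g => ?_)
    (tendsto_iff_norm_sub_tendsto_zero.1 hlim) (one_lt_toReal hp hp')) hSp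
  rw [sub_apply, sub_apply, inner_sub_left, inner_sub_right, hE.symm, hE.proj_symm]
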